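/- **Setting.** A three-qubit state is of GHZ class if it can be written as $|\psi\rangle=\tfrac1{\sqrt2}\big(\alpha|a_1b_1c_1\rangle+\beta|a_2b_2c_2\rangle\big)$ with nonzero $\alpha,\beta$ and unit vectors such that $|a_1\rangle,|a_2\rangle$ are linearly independent, and likewise $|b_1\rangle,|b_2\rangle$ and $|c_1\rangle,|c_2\rangle$; the two terms are unique up to order. The interference term of a normalized GHZ-class state is $I(\psi)=\operatorname{Re}\big(\bar\alpha\beta\,\langle a_1b_1c_1|a_2b_2c_2\rangle\big)$. Let $\tau_{ABC}$ be the Coffman–Kundu–Wootters 3-tangle and let $$T(x)=\max\{\tau_{ABC}(\phi):\ \phi \text{ normalized, of GHZ class},\ I(\phi)=x\}\quad(x<\tfrac12),\qquad T(\tfrac12)=0$$ (no GHZ-class state has $I\ge\frac12$). Let $P(\psi\to\phi)$ be the optimal LOCC probability: the supremum, over all protocols of finitely many rounds of local measurements (with arbitrary local Kraus operators between finite-dimensional spaces, depending on earlier outcomes), of the total probability of the branches that end in $|\phi\rangle$ up to a scalar. For normalized GHZ-class states $\psi,\phi$ and real $x\le\frac12$ with $x\ne I(\phi)$ put $$p_{as}(x)=\frac{I(\psi)-x}{I(\phi)-x}\quad\text{(the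 solution of } p_{as}\,I(\phi)+(1-p_{as})\,x=I(\psi)),\qquad p_u(x)=1-p_{as}(x),$$ $$p_m(s|x)=\min\Big(\frac{T(x)}{\tau_{ABC}(\phi)},1\Big),\qquad \bar p_s(x)=p_{as}(x)+p_u(x)\,p_m(s|x).$$ **Theorem.** The maximum defining $T(x)$ is attained for every $x<\frac12$, and the following hold. 1. Let $0<c<1$, $|a\rangle=c|0\rangle+\sqrt{1-c^2}\,|1\rangle$, $\psi=\mathrm{GHZ}=\frac1{\sqrt2}(|000\rangle+|111\rangle)$ and $\phi=\gamma(|000\rangle+|aaa\rangle)$ with $\gamma=(2+2c^3)^{-1/2}$. Then $p_{as}(-x)=\dfrac{x}{\frac{c^3}{1+c^3}+x}$ for $x\ge0$. For $z\ge 0$ put $$p^U(-z)=\frac{z}{I(\phi)+z},\qquad \bar p_{\tau_{ABC}}(-z)=\min_{0\le x\le z}\bar p_s(-x),\qquad p_{bound}(-z)=\min\big(p^U(-z),\bar p_{\tau_{ABC}}(-z)\big),$$ where the minimum over $[0,z]$ is attained. Then $p_{bound}(-z)$ has a maximum over $z\in[0,\infty)$, $\bar p_s(-z)$ has a minimum over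 $z\in[0,\infty)$, the two are equal, and $$P(\mathrm{GHZ}\to\phi)\ \le\ \max_{z\ge0}p_{bound}(-z)\ =\ \min_{z\ge0}\bar p_s(-z).$$ 2. Let $\psi,\phi$ be any normalized GHZ-class states. If $I(\phi)>I(\psi)$, then $\bar p_s$ attains a minimum on $(-\infty,I(\psi)]$ and $P(\psi\to\phi)\le\min_{x\le I(\psi)}\bar p_s(x)$. If $I(\phi)<I(\psi)$, then $\bar p_s$ attains a minimum on $[I(\psi),\frac12]$ and $P(\psi\to\phi)\le\min_{I(\psi)\le x\le 1/2}\bar p_s(x)$. -/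

import Mathlib

/-- Pure (not necessarily normalized) state vectors of three parties, Alice, Bob and Charlie, whose
local Hilbert spaces have dimensions `a`, `b` and `c`. -/
abbrev TriState (a b c : ℕ) : Type := EuclideanSpace ℂ (Fin a × Fin b × Fin c)

namespace TriState

/-- The product vector `|x⟩ ⊗ |y⟩ ⊗ |z⟩`. -/
noncomputable def prodVec (x y z : EuclideanSpace ℂ (Fin 2)) : TriState 2 2 2 :=
  WithLp.toLp 2 fun p => x p.1 * y p.2.1 * z p.2.2

/-- `ψ = u + v` is a two-term product decomposition of GHZ type: `u = |a₁ b₁ c₁⟩`, `v = |a₂ b₂ c₂⟩`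
with linearly independent local factors (the factors are not normalized). -/
def IsGHZDecomp (ψ u v : TriState 2 2 2) : Prop :=
  ∃ a₁ a₂ b₁ b₂ c₁ c₂ : EuclideanSpace ℂ (Fin 2),
    LinearIndependent ℂ ![a₁, a₂] ∧ LinearIndependent ℂ ![b₁, b₂] ∧ LinearIndependent ℂ ![c₁, c₂] ∧
    u = prodVec a₁ b₁ c₁ ∧ v = prodVec a₂ b₂ c₂ ∧ ψ = u + v

/-- The GHZ class of three-qubit states. -/
def IsGHZClass (ψ : TriState 2 2 2) : Prop := ∃ u v, IsGHZDecomp ψ u v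

open Classical in
/-- The interference term of a GHZ-class state. If
`ψ = (α |a₁ b₁ c₁⟩ + β |a₂ b₂ c₂⟩) / √2` with normalized product vectors, it is the real part of
`conj α * β * ⟨a₁ b₁ c₁|a₂ b₂ c₂⟩`, that is, `2 Re ⟨u|v⟩` where `u` and `v` are the two terms.
The terms are unique up to order, see `interference_eq`. -/
noncomputable def interference (ψ : TriState 2 2 2) : ℝ :=
  if h : ∃ p : TriState 2 2 2 × TriState 2 2 2, IsGHZDecomp ψ p.1 p.2 then
    2 * (inner ℂ h.choose.1 h.choose.2).re
  else 0

theorem det_ne_zero_of_linearIndependent {x y : EuclideanSpace ℂ (Fin 2)}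
    (h : LinearIndependent ℂ ![x, y]) : x 0 * y 1 - x 1 * y 0 ≠ 0 := by
  intro hd
  rw [LinearIndependent.pair_iff] at h
  have h1 := h (y 1) (-(x 1)) (by
    ext i; fin_cases i
    · simp; linear_combination hd
    · simp; ring)
  have h2 := h (y 0) (-(x 0)) (by
    ext i; fin_cases i
    · simp; ring
    · simp; linear_combination -hd)
  have h3 := h 1 0 (by
    ext i; fin_cases i
    · simpa using h2.2
    · simpa using h1.2)
  exact one_ne_zero h3.1

/-- Uniqueness of the two-term product decomposition. -/
theorem IsGHZDecomp.unique {ψ u v u' v' : TriState 2 2 2} (h : IsGHZDecomp ψ u v)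
    (h' : IsGHZDecomp ψ u' v') : (u' = u ∧ v' = v) ∨ (u' = v ∧ v' = u) := by
  obtain ⟨a, A, b, B, c, C, ha, hb, hc, rfl, rfl, rfl⟩ := h
  obtain ⟨x, X, y, Y, z, Z, hx, hy, hz, rfl, rfl, he⟩ := h'
  replace ha := det_ne_zero_of_linearIndependent ha
  replace hb := det_ne_zero_of_linearIndependent hb
  replace hx := det_ne_zero_of_linearIndependent hx
  replace hy := det_ne_zero_of_linearIndependent hy
  replace hz := det_ne_zero_of_linearIndependent hz
  have e : ∀ i j k, a i * b j * c k + A i * B j * C k = x i * y j * z k + X i * Y j * Z k := by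
    intro i j k
    have := congrArg (fun w : TriState 2 2 2 => w (i, j, k)) he
    simpa [prodVec] using this
  set D := z 0 * Z 1 - z 1 * Z 0 with hD
  obtain ⟨s, hs⟩ : ∃ s, s * D = c 0 * Z 1 - c 1 * Z 0 := ⟨_, div_mul_cancel₀ _ hz⟩
  obtain ⟨t, ht⟩ : ∃ t, t * D = C 0 * Z 1 - C 1 * Z 0 := ⟨_, div_mul_cancel₀ _ hz⟩
  obtain ⟨S, hS⟩ : ∃ S, S * D = z 0 * c 1 - z 1 * c 0 := ⟨_, div_mul_cancel₀ _ hz⟩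
  obtain ⟨T, hT⟩ : ∃ T, T * D = z 0 * C 1 - z 1 * C 0 := ⟨_, div_mul_cancel₀ _ hz⟩
  have f : ∀ i j, x i * y j = s * (a i * b j) + t * (A i * B j) := by
    intro i j
    apply mul_right_cancel₀ hz
    linear_combination -(a i * b j) * hs - (A i * B j) * ht - Z 1 * e i j 0 + Z 0 * e i j 1
  have g : ∀ i j, X i * Y j = S * (a i * b j) + T * (A i * B j) := by
    intro i j
    apply mul_right_cancel₀ hz
    linear_combination -(a i * b j) * hS - (A i * B j) * hT + z 1 * e i j 0 - z 0 * e i j 1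
  have hcs : ∀ k, c k = s * z k + S * Z k := by
    intro k
    apply mul_right_cancel₀ hz
    fin_cases k
    · change c 0 * D = (_ * z 0 + _ * Z 0) * D
      linear_combination -z 0 * hs - Z 0 * hS + c 0 * hD
    · change c 1 * D = (_ * z 1 + _ * Z 1) * D
      linear_combination -z 1 * hs - Z 1 * hS + c 1 * hD
  have hCs : ∀ k, C k = t * z k + T * Z k := by
    intro k
    apply mul_right_cancel₀ hz
    fin_cases k
    · change C 0 * D = (_ * z 0 + _ * Z 0) * D
      linear_combination -z 0 * ht - Z 0 * hT + C 0 * hD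
    · change C 1 * D = (_ * z 1 + _ * Z 1) * D
      linear_combination -z 1 * ht - Z 1 * hT + C 1 * hD
  have hst : s * t = 0 := by
    have : s * t * ((a 0 * A 1 - a 1 * A 0) * (b 0 * B 1 - b 1 * B 0)) = 0 := by
      have h0 : (x 0 * y 0) * (x 1 * y 1) = (x 0 * y 1) * (x 1 * y 0) := by ring
      rw [f, f, f, f] at h0
      linear_combination h0
    exact (mul_eq_zero.1 this).resolve_right (mul_ne_zero ha hb)
  have hST : S * T = 0 := by
    have : S * T * ((a 0 * A 1 - a 1 * A 0) * (b 0 * B 1 - b 1 * B 0)) = 0 := by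
      have h0 : (X 0 * Y 0) * (X 1 * Y 1) = (X 0 * Y 1) * (X 1 * Y 0) := by ring
      rw [g, g, g, g] at h0
      linear_combination h0
    exact (mul_eq_zero.1 this).resolve_right (mul_ne_zero ha hb)
  have key : s * T + t * S ≠ 0 := by
    intro h0
    have h1 : (x 0 * X 1 - x 1 * X 0) * (y 0 * Y 1 - y 1 * Y 0) = 0 := by
      have h2 : (x 0 * X 1 - x 1 * X 0) * (y 0 * Y 1 - y 1 * Y 0) =
        (x 0 * y 0) * (X 1 * Y 1) - (x 0 * y 1) * (X 1 * Y 0) - (x 1 * y 0) * (X 0 * Y 1)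
          + (x 1 * y 1) * (X 0 * Y 0) := by ring
      rw [h2, f, f, f, f, g, g, g, g]
      linear_combination
        (a 0 * A 1 - a 1 * A 0) * (b 0 * B 1 - b 1 * B 0) * h0
    exact mul_ne_zero hx hy h1
  rcases mul_eq_zero.1 hst with h0 | h0
  · right
    have hT0 : T = 0 := (mul_eq_zero.1 hST).resolve_left (by rintro rfl; simp [h0] at key)
    constructor
    · ext ⟨i, j, k⟩
      simp only [prodVec]
      rw [f, hCs, h0, hT0]; ring
    · ext ⟨i, j, k⟩
      simp only [prodVec]
      rw [g, hcs, h0, hT0]; ring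
  · left
    have hS0 : S = 0 := (mul_eq_zero.1 hST).resolve_right (by rintro rfl; simp [h0] at key)
    constructor
    · ext ⟨i, j, k⟩
      simp only [prodVec]
      rw [f, hcs, h0, hS0]; ring
    · ext ⟨i, j, k⟩
      simp only [prodVec]
      rw [g, hCs, h0, hS0]; ring

/-- The interference term does not depend on the choice of the decomposition. -/
theorem interference_eq {ψ u v : TriState 2 2 2} (h : IsGHZDecomp ψ u v) :
    interference ψ = 2 * (inner ℂ u v).re := by
  have hex : ∃ p : TriState 2 2 2 × TriState 2 2 2, IsGHZDecomp ψ p.1 p.2 := ⟨(u, v), h⟩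
  rw [interference, dif_pos hex]
  rcases h.unique hex.choose_spec with ⟨h1, h2⟩ | ⟨h1, h2⟩
  · rw [h1, h2]
  · rw [h1, h2]
    have h3 : (inner ℂ v u).re = (inner ℂ u v).re := inner_re_symm (𝕜 := ℂ) v u
    rw [h3]

/-- The 3-tangle `4 |d₁ - 2 d₂ + 4 d₃|` of Coffman, Kundu and Wootters of a (normalized) pure state
of three qubits. -/
noncomputable def tangle (ψ : TriState 2 2 2) : ℝ :=
  let t : Fin 2 → Fin 2 → Fin 2 → ℂ := fun i j k => ψ (i, j, k)
  let d₁ := t 0 0 0 ^ 2 * t 1 1 1 ^ 2 + t 0 0 1 ^ 2 * t 1 1 0 ^ 2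
    + t 0 1 0 ^ 2 * t 1 0 1 ^ 2 + t 1 0 0 ^ 2 * t 0 1 1 ^ 2
  let d₂ := t 0 0 0 * t 1 1 1 * t 0 1 1 * t 1 0 0 + t 0 0 0 * t 1 1 1 * t 1 0 1 * t 0 1 0
    + t 0 0 0 * t 1 1 1 * t 1 1 0 * t 0 0 1 + t 0 1 1 * t 1 0 0 * t 1 0 1 * t 0 1 0
    + t 0 1 1 * t 1 0 0 * t 1 1 0 * t 0 0 1 + t 1 0 1 * t 0 1 0 * t 1 1 0 * t 0 0 1
  let d₃ := t 0 0 0 * t 1 1 0 * t 1 0 1 * t 0 1 1 + t 1 1 1 * t 0 0 1 * t 0 1 0 * t 1 0 0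
  4 * ‖d₁ - 2 * d₂ + 4 * d₃‖

/-- The 3-tangles of all normalized GHZ-class states with interference term `x`. -/
def tangleSet (x : ℝ) : Set ℝ :=
  {τ | ∃ φ : TriState 2 2 2, ‖φ‖ = 1 ∧ IsGHZClass φ ∧ interference φ = x ∧ tangle φ = τ}

/-- The maximal 3-tangle of a normalized GHZ-class state with interference term `x`. For `x ≥ 1/2`
there is no such state, and the value is `0`. -/
noncomputable def maxTangle (x : ℝ) : ℝ := sSup (tangleSet x)

/-- The action of an operator of Alice, with matrix `K`. -/
noncomputable def actA {a b c d : ℕ} (K : Matrix (Fin d) (Fin a) ℂ) (ψ : TriState a b c) :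
    TriState d b c :=
  WithLp.toLp 2 fun p => ∑ i, K p.1 i * ψ (i, p.2.1, p.2.2)

/-- The action of an operator of Bob, with matrix `K`. -/
noncomputable def actB {a b c d : ℕ} (K : Matrix (Fin d) (Fin b) ℂ) (ψ : TriState a b c) :
    TriState a d c :=
  WithLp.toLp 2 fun p => ∑ j, K p.2.1 j * ψ (p.1, j, p.2.2)

/-- The action of an operator of Charlie, with matrix `K`. -/
noncomputable def actC {a b c d : ℕ} (K : Matrix (Fin d) (Fin c) ℂ) (ψ : TriState a b c) :
    TriState a b d :=
  WithLp.toLp 2 fun p => ∑ k, K p.2.2 k * ψ (p.1, p.2.1, k)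

theorem sum_normSq_mulVec {a n : ℕ} (d : Fin n → ℕ) (K : ∀ i, Matrix (Fin (d i)) (Fin a) ℂ)
    (h : ∑ i, (K i).conjTranspose * K i = 1) (x : Fin a → ℂ) :
    ∑ i, ∑ r, ‖∑ j, K i r j * x j‖ ^ 2 = ∑ j, ‖x j‖ ^ 2 := by
  have key : ∀ {m : ℕ} (y : Fin m → ℂ), ((∑ j, ‖y j‖ ^ 2 : ℝ) : ℂ) = dotProduct (star y) y := by
    intro m y
    simp [dotProduct, Complex.conj_mul']
  have h1 : ((∑ i, ∑ r, ‖∑ j, K i r j * x j‖ ^ 2 : ℝ) : ℂ) = ((∑ j, ‖x j‖ ^ 2 : ℝ) : ℂ) := by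
    rw [Complex.ofReal_sum, key x]
    have h2 : ∀ i, ((∑ r, ‖∑ j, K i r j * x j‖ ^ 2 : ℝ) : ℂ) =
        dotProduct (star x) (((K i).conjTranspose * K i).mulVec x) := by
      intro i
      have := key ((K i).mulVec x)
      rw [Matrix.star_mulVec, ← Matrix.dotProduct_mulVec, Matrix.mulVec_mulVec] at this
      exact this
    simp_rw [h2]
    rw [← dotProduct_sum, ← Matrix.sum_mulVec, h, Matrix.one_mulVec]
  exact_mod_cast h1

theorem sum_normSq_actA {a b c n : ℕ} (d : Fin n → ℕ) (K : ∀ i, Matrix (Fin (d i)) (Fin a) ℂ)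
    (h : ∑ i, (K i).conjTranspose * K i = 1) (ψ : TriState a b c) :
    ∑ i, ‖actA (K i) ψ‖ ^ 2 = ‖ψ‖ ^ 2 := by
  simp only [EuclideanSpace.norm_sq_eq, actA, Fintype.sum_prod_type_right]
  rw [Finset.sum_comm]
  refine Finset.sum_congr rfl fun k _ => ?_
  rw [Finset.sum_comm]
  exact Finset.sum_congr rfl fun j _ => sum_normSq_mulVec d K h fun i => ψ (i, j, k)

theorem sum_normSq_actB {a b c n : ℕ} (d : Fin n → ℕ) (K : ∀ i, Matrix (Fin (d i)) (Fin b) ℂ)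
    (h : ∑ i, (K i).conjTranspose * K i = 1) (ψ : TriState a b c) :
    ∑ i, ‖actB (K i) ψ‖ ^ 2 = ‖ψ‖ ^ 2 := by
  simp only [EuclideanSpace.norm_sq_eq, actB, Fintype.sum_prod_type]
  rw [Finset.sum_comm]
  refine Finset.sum_congr rfl fun i _ => ?_
  refine (Finset.sum_congr rfl fun _ _ => Finset.sum_comm).trans ?_
  refine Finset.sum_comm.trans (Eq.trans ?_ Finset.sum_comm)
  exact Finset.sum_congr rfl fun k _ => sum_normSq_mulVec d K h fun j => ψ (i, j, k)

theorem sum_normSq_actC {a b c n : ℕ} (d : Fin n → ℕ) (K : ∀ i, Matrix (Fin (d i)) (Fin c) ℂ)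
    (h : ∑ i, (K i).conjTranspose * K i = 1) (ψ : TriState a b c) :
    ∑ i, ‖actC (K i) ψ‖ ^ 2 = ‖ψ‖ ^ 2 := by
  simp only [EuclideanSpace.norm_sq_eq, actC, Fintype.sum_prod_type]
  rw [Finset.sum_comm]
  refine Finset.sum_congr rfl fun i _ => ?_
  rw [Finset.sum_comm]
  exact Finset.sum_congr rfl fun j _ => sum_normSq_mulVec d K h fun k => ψ (i, j, k)

end TriState

open TriState

/-- LOCC protocols that turn a system with local dimensions `a`, `b`, `c` into three qubits. In each
round one party performs a generalized measurement with Kraus operators `K i`, `∑ i, (K i)ᴴ * K i = 1`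
(the dimension of that party's system may change, so local ancillas are allowed) and broadcasts the
outcome `i`, on which the remaining protocol `next i` may depend. -/
inductive LOCC : ℕ → ℕ → ℕ → Type
  | done : LOCC 2 2 2
  | alice {a b c n : ℕ} (d : Fin n → ℕ) (K : ∀ i, Matrix (Fin (d i)) (Fin a) ℂ)
      (complete : ∑ i, (K i).conjTranspose * K i = 1) (next : ∀ i, LOCC (d i) b c) : LOCC a b c
  | bob {a b c n : ℕ} (d : Fin n → ℕ) (K : ∀ i, Matrix (Fin (d i)) (Fin b) ℂ)
      (complete : ∑ i, (K i).conjTranspose * K i = 1) (next : ∀ i, LOCC a (d i) c) : LOCC a b c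
  | charlie {a b c n : ℕ} (d : Fin n → ℕ) (K : ∀ i, Matrix (Fin (d i)) (Fin c) ℂ)
      (complete : ∑ i, (K i).conjTranspose * K i = 1) (next : ∀ i, LOCC a b (d i)) : LOCC a b c

open Classical in
/-- The total probability of the branches of a protocol, run on the normalized state `ψ`, whose final
state is proportional to the target `φ`. The vector of a branch is the product of its Kraus operators
applied to `ψ`, and its squared norm is the probability of the branch. -/
noncomputable def LOCC.successProb (φ : TriState 2 2 2) :
    {a b c : ℕ} → LOCC a b c → TriState a b c → ℝ
  | _, _, _, .done, ψ => if ∃ z : ℂ, ψ = z • φ then ‖ψ‖ ^ 2 else 0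
  | _, _, _, .alice _ K _ next, ψ => ∑ i, (next i).successProb φ (actA (K i) ψ)
  | _, _, _, .bob _ K _ next, ψ => ∑ i, (next i).successProb φ (actB (K i) ψ)
  | _, _, _, .charlie _ K _ next, ψ => ∑ i, (next i).successProb φ (actC (K i) ψ)

theorem LOCC.successProb_le (φ : TriState 2 2 2) {a b c : ℕ} (P : LOCC a b c) :
    ∀ ψ : TriState a b c, P.successProb φ ψ ≤ ‖ψ‖ ^ 2 := by
  induction P with
  | done =>
    intro ψ
    rw [LOCC.successProb]
    split_ifs
    · exact le_rfl
    · positivity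
  | alice d K complete next ih =>
    intro ψ
    rw [LOCC.successProb, ← sum_normSq_actA d K complete ψ]
    exact Finset.sum_le_sum fun i _ => ih i _
  | bob d K complete next ih =>
    intro ψ
    rw [LOCC.successProb, ← sum_normSq_actB d K complete ψ]
    exact Finset.sum_le_sum fun i _ => ih i _
  | charlie d K complete next ih =>
    intro ψ
    rw [LOCC.successProb, ← sum_normSq_actC d K complete ψ]
    exact Finset.sum_le_sum fun i _ => ih i _

/-- The set of success probabilities is bounded above, so its supremum is a genuine one. -/
theorem LOCC.bddAbove_successProb (ψ φ : TriState 2 2 2) :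
    BddAbove (Set.range fun P : LOCC 2 2 2 => P.successProb φ ψ) := by
  refine ⟨‖ψ‖ ^ 2, ?_⟩
  rintro _ ⟨P, rfl⟩
  exact P.successProb_le φ ψ

namespace TriState

/-- The optimal (supremal) LOCC probability of the transformation `ψ → φ`. -/
noncomputable def optProb (ψ φ : TriState 2 2 2) : ℝ :=
  sSup (Set.range fun P : LOCC 2 2 2 => P.successProb φ ψ)

/-- The probability of the already successful branches, determined by conservation of the interference
term: the solution `p` of `p * I(φ) + (1 - p) * x = I(ψ)`. -/
noncomputable def pAlready (ψ φ : TriState 2 2 2) (x : ℝ) : ℝ :=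
  (interference ψ - x) / (interference φ - x)

/-- The bound on the probability to transform a GHZ-class state with interference term `x` into `φ`. -/
noncomputable def pMax (φ : TriState 2 2 2) (x : ℝ) : ℝ := min (maxTangle x / tangle φ) 1

/-- The bound on the success probability of `ψ → φ` obtained by stopping at interference term `x`. -/
noncomputable def pBar (ψ φ : TriState 2 2 2) (x : ℝ) : ℝ :=
  pAlready ψ φ x + (1 - pAlready ψ φ x) * pMax φ x

/-- The state `(|000⟩ + |111⟩) / √2`. -/
noncomputable def ghz : TriState 2 2 2 :=
  ((1 / √2 : ℝ) : ℂ) • (prodVec !₂[1, 0] !₂[1, 0] !₂[1, 0] + prodVec !₂[0, 1] !₂[0, 1] !₂[0, 1])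

/-- The state `γ (|000⟩ + |aaa⟩)` with `|a⟩ = c |0⟩ + √(1 - c²) |1⟩` and normalization `γ > 0`. -/
noncomputable def target (c : ℝ) : TriState 2 2 2 :=
  ((1 / √(2 + 2 * c ^ 3) : ℝ) : ℂ) • (prodVec !₂[1, 0] !₂[1, 0] !₂[1, 0] +
    prodVec !₂[(c : ℂ), (√(1 - c ^ 2) : ℝ)] !₂[(c : ℂ), (√(1 - c ^ 2) : ℝ)]
      !₂[(c : ℂ), (√(1 - c ^ 2) : ℝ)])

/-- The bound `z / (I(φ) + z)` for protocols from the GHZ state to `φ` whose failure branches all have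
interference term at least `-z`. -/
noncomputable def pU (φ : TriState 2 2 2) (z : ℝ) : ℝ := z / (interference φ + z)

/-- The minimum of `pBar ghz φ (-x)` over `0 ≤ x ≤ z`. -/
noncomputable def pTangle (φ : TriState 2 2 2) (z : ℝ) : ℝ :=
  sInf ((fun x => pBar ghz φ (-x)) '' Set.Icc 0 z)

/-- The bound for protocols whose minimal interference term of a failure branch is `-z`. -/
noncomputable def pBound (φ : TriState 2 2 2) (z : ℝ) : ℝ := min (pU φ z) (pTangle φ z)

end TriState

/-! Every branch of a protocol started in a GHZ-class state is the image of |000⟩ + |111⟩ under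
three local matrices. The squared norm, interference term and (unnormalized) 3-tangle depend only on
the Gram data of the column pairs: the first two are real-linear in each party's Gram form, the
third is a product of determinants. A complete measurement splits the acting party's Gram form into
a sum. So any function of the three forms that is nonnegative, superadditive in each argument, and
at least the squared norm at multiples of φ bounds the success probability by its initial value
(`LOCC.successProb_le_potential`).

For a threshold x and m = min(T(x)/τ(φ), 1), `Herm.potential` is such a function. On the φ-side of x
it is the smaller of m·N + (1 - m)·D and the tangle potential, where N is the squared norm and D the
normalized deviation of the interference term from x; beyond x only the tangle potential remains. If
ψ lies on the φ-side, the value at ψ is at most the bound `pBar` at x. The linear part is additive;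
the tangle part is superadditive because the determinant is a Lorentzian quadratic form
(`Herm.det_div_normForm_add_le`). When two summands lie on different sides of x, enough of one is
merged into the other to reach x exactly, where the tangle is at most T(x).

The closed form of T follows from AM–GM and Hölder (`Herm.detForm_le`), with equality at symmetric
states. The minima exist by compactness and, on the unbounded side, because the bound is squeezed to
1 at -∞. From the GHZ state, `pU` increases and lies below `pBar`, which makes the max-min equal to
the minimum. -/

/-! ### Hermitian forms in two variables -/

/-- A Hermitian `2 × 2` matrix, given by its diagonal entries and its upper off-diagonal entry. -/
abbrev Herm : Type := ℝ × ℝ × ℂ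

namespace Herm

/-- The determinant of a Hermitian `2 × 2` matrix. -/
def det (g : Herm) : ℝ := g.1 * g.2.1 - Complex.normSq g.2.2

/-- Positive semidefinite Hermitian `2 × 2` matrices. -/
def PSD (g : Herm) : Prop := 0 ≤ g.1 ∧ 0 ≤ g.2.1 ∧ 0 ≤ g.det

/-- The trilinear form whose value at the Gram data of three pairs of vectors is the squared norm of
the sum of the two product vectors. -/
def normForm (g h k : Herm) : ℝ :=
  g.1 * h.1 * k.1 + g.2.1 * h.2.1 * k.2.1 + 2 * (g.2.2 * h.2.2 * k.2.2).re

/-- The trilinear form of the interference term. -/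
def interf (g h k : Herm) : ℝ := 2 * (g.2.2 * h.2.2 * k.2.2).re

/-- The product of the determinants, normalized such that it gives the 3-tangle. -/
def detForm (g h k : Herm) : ℝ := 4 * (g.det * h.det * k.det)

theorem normForm_comm₁₂ (g h k : Herm) : normForm g h k = normForm h g k := by
  rw [normForm, normForm, mul_comm g.2.2 h.2.2]; ring

theorem normForm_comm₁₃ (g h k : Herm) : normForm g h k = normForm k h g := by
  rw [normForm, normForm, show k.2.2 * h.2.2 * g.2.2 = g.2.2 * h.2.2 * k.2.2 by ring]; ring

theorem interf_comm₁₂ (g h k : Herm) : interf g h k = interf h g k := by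
  rw [interf, interf, mul_comm g.2.2 h.2.2]

theorem interf_comm₁₃ (g h k : Herm) : interf g h k = interf k h g := by
  rw [interf, interf, show k.2.2 * h.2.2 * g.2.2 = g.2.2 * h.2.2 * k.2.2 by ring]

theorem detForm_comm₁₂ (g h k : Herm) : detForm g h k = detForm h g k := by
  rw [detForm, detForm]; ring

theorem detForm_comm₁₃ (g h k : Herm) : detForm g h k = detForm k h g := by
  rw [detForm, detForm]; ring

theorem normForm_add (g g' h k : Herm) :
    normForm (g + g') h k = normForm g h k + normForm g' h k := by
  simp only [normForm, Prod.fst_add, Prod.snd_add, add_mul, Complex.add_re]; ring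

theorem interf_add (g g' h k : Herm) : interf (g + g') h k = interf g h k + interf g' h k := by
  simp only [interf, Prod.snd_add, add_mul, Complex.add_re]; ring

theorem normForm_smul (s : ℝ) (g h k : Herm) : normForm (s • g) h k = s * normForm g h k := by
  simp only [normForm, Prod.smul_fst, Prod.smul_snd, smul_mul_assoc, Complex.smul_re, smul_eq_mul]
  ring

theorem interf_smul (s : ℝ) (g h k : Herm) : interf (s • g) h k = s * interf g h k := by
  simp only [interf, Prod.smul_snd, smul_mul_assoc, Complex.smul_re, smul_eq_mul]
  ring

theorem det_smul (s : ℝ) (g : Herm) : det (s • g) = s ^ 2 * det g := by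
  simp only [det, Prod.smul_fst, Prod.smul_snd, Complex.real_smul, smul_eq_mul, Complex.normSq_mul,
    Complex.normSq_ofReal]
  ring

theorem PSD.smul {g : Herm} (hg : g.PSD) {s : ℝ} (hs : 0 ≤ s) : (s • g).PSD :=
  ⟨mul_nonneg hs hg.1, mul_nonneg hs hg.2.1, by
    rw [det_smul]; exact mul_nonneg (sq_nonneg s) hg.2.2⟩

theorem PSD.zero : PSD 0 := by simp [PSD, det]

theorem PSD.normSq_le {g : Herm} (hg : g.PSD) : Complex.normSq g.2.2 ≤ g.1 * g.2.1 :=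
  sub_nonneg.1 hg.2.2

/-- The real Cauchy–Schwarz type estimate behind all the positivity statements. -/
theorem abs_re_mul_le {p r p' r' : ℝ} {q q' : ℂ} (hp : 0 ≤ p) (hr : 0 ≤ r) (hp' : 0 ≤ p')
    (hr' : 0 ≤ r') (h : Complex.normSq q ≤ p * r) (h' : Complex.normSq q' ≤ p' * r') :
    2 * |(q * q').re| ≤ p * p' + r * r' := by
  have h1 : |(q * q').re| ≤ ‖q * q'‖ := Complex.abs_re_le_norm _
  have h2 : ‖q * q'‖ ^ 2 ≤ (p * p') * (r * r') := by
    rw [← Complex.normSq_eq_norm_sq, Complex.normSq_mul]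
    calc _ ≤ (p * r) * (p' * r') :=
          mul_le_mul h h' (Complex.normSq_nonneg _) (mul_nonneg hp hr)
      _ = _ := by ring
  have h3 : (2 * ‖q * q'‖) ^ 2 ≤ (p * p' + r * r') ^ 2 := by
    nlinarith [sq_nonneg (p * p' - r * r')]
  linarith [(abs_le.1 (abs_le_of_sq_le_sq h3 (by positivity))).2]

theorem PSD.add {g g' : Herm} (hg : g.PSD) (hg' : g'.PSD) : (g + g').PSD := by
  refine ⟨add_nonneg hg.1 hg'.1, add_nonneg hg.2.1 hg'.2.1, ?_⟩
  -- Swapping the diagonal of `g'` and conjugating its off-diagonal entry turns the estimate into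
  -- nonnegativity of the mixed term of the determinant of the sum.
  have h := abs_re_mul_le (q' := (starRingEnd ℂ) g'.2.2) hg.1 hg.2.1 hg'.2.1 hg'.1 hg.normSq_le
    (by rw [Complex.normSq_conj, mul_comm]; exact hg'.normSq_le)
  have h1 := le_abs_self (g.2.2 * (starRingEnd ℂ) g'.2.2).re
  have h2 := hg.normSq_le
  have h3 := hg'.normSq_le
  simp only [det, Prod.fst_add, Prod.snd_add, Complex.normSq_add]
  linarith

/-- A semidefinite form contracted with two of the three arguments of `normForm`. -/
theorem PSD.contract {h k : Herm} (hh : h.PSD) (hk : k.PSD) :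
    PSD (h.1 * k.1, h.2.1 * k.2.1, h.2.2 * k.2.2) := by
  refine ⟨mul_nonneg hh.1 hk.1, mul_nonneg hh.2.1 hk.2.1, ?_⟩
  have := mul_le_mul hh.normSq_le hk.normSq_le (Complex.normSq_nonneg _)
    (mul_nonneg hh.1 hh.2.1)
  simp only [det, Complex.normSq_mul]
  linarith

theorem abs_interf_le {g h k : Herm} (hg : g.PSD) (hh : h.PSD) (hk : k.PSD) :
    |interf g h k| ≤ g.1 * h.1 * k.1 + g.2.1 * h.2.1 * k.2.1 := by
  have hc := hh.contract hk
  have := abs_re_mul_le hg.1 hg.2.1 hc.1 hc.2.1 hg.normSq_le hc.normSq_le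
  rw [interf, abs_mul, abs_two, mul_assoc]
  linarith

theorem normForm_nonneg {g h k : Herm} (hg : g.PSD) (hh : h.PSD) (hk : k.PSD) :
    0 ≤ normForm g h k := by
  have := (abs_le.1 (abs_interf_le hg hh hk)).1
  rw [interf] at this
  rw [normForm]
  linarith

theorem detForm_nonneg {g h k : Herm} (hg : g.PSD) (hh : h.PSD) (hk : k.PSD) :
    0 ≤ detForm g h k :=
  mul_nonneg zero_le_four (mul_nonneg (mul_nonneg hg.2.2 hh.2.2) hk.2.2)

/-- A definite Hermitian form is not orthogonal to a nonzero semidefinite one. -/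
theorem det_nonpos_of_orthogonal {p r : ℝ} {q : ℂ} {m : Herm} (hm : m.PSD)
    (hm0 : 0 < m.1 ∨ 0 < m.2.1) (h : p * m.1 + r * m.2.1 + 2 * (q * m.2.2).re = 0) :
    p * r - Complex.normSq q ≤ 0 := by
  by_contra! hd
  have hpr : 0 < p * r := by linarith [Complex.normSq_nonneg q]
  have key : ∀ {p r : ℝ} {q : ℂ}, 0 < p → 0 < r → 0 < p * r - Complex.normSq q →
      0 < p * m.1 + r * m.2.1 + 2 * (q * m.2.2).re := by
    intro p r q hp hr hd
    have hs := hm.normSq_le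
    have h1 : |(q * m.2.2).re| ≤ ‖q * m.2.2‖ := Complex.abs_re_le_norm _
    have hsum : 0 < p * m.1 + r * m.2.1 := by
      rcases hm0 with h0 | h0
      · have := mul_pos hp h0; have := mul_nonneg hr.le hm.2.1; linarith
      · have := mul_pos hr h0; have := mul_nonneg hp.le hm.1; linarith
    have h3 : (2 * ‖q * m.2.2‖) ^ 2 < (p * m.1 + r * m.2.1) ^ 2 := by
      rw [mul_pow, ← Complex.normSq_eq_norm_sq, Complex.normSq_mul]
      have e1 : Complex.normSq q * Complex.normSq m.2.2 ≤ Complex.normSq q * (m.1 * m.2.1) :=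
        mul_le_mul_of_nonneg_left hs (Complex.normSq_nonneg _)
      have e2 : 0 ≤ (p * r - Complex.normSq q) * (m.1 * m.2.1) :=
        mul_nonneg hd.le (mul_nonneg hm.1 hm.2.1)
      by_cases h0 : m.1 * m.2.1 = 0
      -- Here the off-diagonal pairing vanishes and strictness comes from `hsum`; in the other case
      -- it comes from the strictly positive determinant `hd`.
      · rw [h0] at e1
        nlinarith [pow_pos hsum 2]
      · have h0' : 0 < m.1 * m.2.1 := lt_of_le_of_ne (mul_nonneg hm.1 hm.2.1) (Ne.symm h0)
        nlinarith [mul_pos hd h0', sq_nonneg (p * m.1 - r * m.2.1)]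
    have h4 := abs_lt_of_sq_lt_sq h3 hsum.le
    linarith [(abs_lt.1 h4).2, (abs_le.1 h1).1]
  -- A positive determinant makes the form positive or negative definite; the second case follows by
  -- changing the sign.
  rcases lt_or_ge 0 p with hp | hp
  · exact (key hp (pos_of_mul_pos_right hpr hp.le) hd).ne' h
  · have hp' : p < 0 := lt_of_le_of_ne hp (by rintro rfl; simp at hpr)
    have hr' : r < 0 := by nlinarith
    have := key (p := -p) (r := -r) (q := -q) (by linarith) (by linarith)
      (by rw [Complex.normSq_neg]; linarith)
    rw [neg_mul q, Complex.neg_re] at this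
    linarith

/-- Superadditivity of `det / normForm`, the monotonicity of the 3-tangle under local measurements. -/
theorem det_div_normForm_add_le {g g' h k : Herm} (hg : g.PSD) (hg' : g'.PSD) (hh : h.PSD)
    (hk : k.PSD) :
    g.det / normForm g h k + g'.det / normForm g' h k ≤ (g + g').det / normForm (g + g') h k := by
  have hN := normForm_nonneg hg hh hk
  have hN' := normForm_nonneg hg' hh hk
  have hmono : ∀ {g g' : Herm}, g.PSD → g'.PSD → g.det ≤ (g + g').det := by
    intro g g' hg hg'
    have h := abs_re_mul_le (q' := (starRingEnd ℂ) g'.2.2) hg.1 hg.2.1 hg'.2.1 hg'.1 hg.normSq_le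
      (by rw [Complex.normSq_conj, mul_comm]; exact hg'.normSq_le)
    have h1 := le_abs_self (g.2.2 * (starRingEnd ℂ) g'.2.2).re
    have h3 := hg'.normSq_le
    simp only [det, Prod.fst_add, Prod.snd_add, Complex.normSq_add]
    linarith
  rw [normForm_add]
  -- At norm zero the quotient is 0 by convention, and only monotonicity of the determinant is
  -- needed.
  rcases hN.eq_or_lt with h0 | h0
  · rw [← h0, div_zero, zero_add, zero_add, add_comm g]
    exact div_le_div_of_nonneg_right (hmono hg' hg) hN'
  rcases hN'.eq_or_lt with h0' | h0'
  · rw [← h0', div_zero, add_zero, add_zero]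
    exact div_le_div_of_nonneg_right (hmono hg hg') hN
  have hc := hh.contract hk
  set n := normForm g h k with hn
  set n' := normForm g' h k with hn'
  -- The form n'g - ng' has `normForm` zero against `h`, `k`, hence nonpositive determinant. After
  -- clearing denominators this is exactly the claim, since the difference of the two sides is
  -- -det(n'g - ng') / (n n' (n + n')).
  have key := det_nonpos_of_orthogonal (p := n' * g.1 - n * g'.1) (r := n' * g.2.1 - n * g'.2.1)
    (q := n' * g.2.2 - n * g'.2.2) hc (by
      by_contra! hz
      have e1 : h.1 * k.1 = 0 := le_antisymm hz.1 hc.1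
      have e2 : h.2.1 * k.2.1 = 0 := le_antisymm hz.2 hc.2.1
      have e3 := abs_interf_le hg hh hk
      rw [mul_assoc, e1, mul_assoc, e2, mul_zero, mul_zero, add_zero] at e3
      have e4 := (abs_le.1 e3).2
      rw [interf] at e4
      rw [hn, normForm, mul_assoc g.1, e1, mul_assoc g.2.1, e2] at h0
      linarith) (by
      have e : ((n' * g.2.2 - n * g'.2.2) * (h.2.2 * k.2.2)).re =
          n' * (g.2.2 * h.2.2 * k.2.2).re - n * (g'.2.2 * h.2.2 * k.2.2).re := by
        rw [← Complex.re_ofReal_mul, ← Complex.re_ofReal_mul, ← Complex.sub_re]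
        congr 1; ring
      simp only [e]
      have e1 : n = _ := hn
      have e2 : n' = _ := hn'
      rw [normForm] at e1 e2
      linear_combination n' * (-e1) + n * e2)
  rw [div_add_div _ _ h0.ne' h0'.ne', div_le_div_iff₀ (mul_pos h0 h0') (add_pos h0 h0')]
  simp only [det, Prod.fst_add, Prod.snd_add, Complex.normSq_apply, Complex.add_re, Complex.add_im,
    Complex.sub_re, Complex.sub_im, Complex.re_ofReal_mul, Complex.im_ofReal_mul] at key ⊢
  linarith

end Herm

/-! ### The 3-tangle at fixed interference term: the upper bound -/

/-- Hölder's inequality for the vectors `(a, 1 - a)`, `(b, 1 - b)` and `(c, 1 - c)`. -/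
theorem prod_one_sub_le {a b c : ℝ} (ha : 0 ≤ a) (hb : 0 ≤ b) (hc : 0 ≤ c) (ha1 : a ≤ 1)
    (hb1 : b ≤ 1) (hc1 : c ≤ 1) :
    (1 - a) * (1 - b) * (1 - c) ≤ (1 - (a * b * c) ^ (1 / 3 : ℝ)) ^ 3 := by
  have ha' := sub_nonneg.2 ha1
  have hb' := sub_nonneg.2 hb1
  have hc' := sub_nonneg.2 hc1
  have key : ∀ {x y z : ℝ}, 0 ≤ x → 0 ≤ y → 0 ≤ z →
      -- AM–GM. Applied to a, b, c and to their complements, the two arithmetic means add up to 1.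
      (x * y * z) ^ (1 / 3 : ℝ) ≤ (x + y + z) / 3 := by
    intro x y z hx hy hz
    have := Real.geom_mean_le_arith_mean3_weighted (w₁ := 1 / 3) (w₂ := 1 / 3) (w₃ := 1 / 3)
      (by norm_num) (by norm_num) (by norm_num) hx hy hz (by norm_num)
    rw [Real.mul_rpow (mul_nonneg hx hy) hz, Real.mul_rpow hx hy]
    linarith
  have h1 := key ha hb hc
  have h2 := key ha' hb' hc'
  have h0 : 0 ≤ (1 - a) * (1 - b) * (1 - c) := mul_nonneg (mul_nonneg ha' hb') hc'
  calc (1 - a) * (1 - b) * (1 - c)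
      = (((1 - a) * (1 - b) * (1 - c)) ^ (1 / 3 : ℝ)) ^ 3 := by
        rw [← Real.rpow_natCast, ← Real.rpow_mul h0]; norm_num
    _ ≤ _ := pow_le_pow_left₀ (Real.rpow_nonneg h0 _) (by linarith) 3

/-- The maximal 3-tangle at interference term `x`, in closed form. -/
noncomputable def tangleBound (x : ℝ) : ℝ :=
  (1 - x) ^ 2 * (1 - ((x / (1 - x)) ^ 2) ^ (1 / 3 : ℝ)) ^ 3

theorem div_one_sub_sq_le_one {x : ℝ} (hx : x ≤ 1 / 2) : (x / (1 - x)) ^ 2 ≤ 1 := by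
  have : 0 < 1 - x := by linarith
  rw [div_pow, div_le_one (by positivity)]
  nlinarith

theorem tangleBound_nonneg {x : ℝ} (hx : x ≤ 1 / 2) : 0 ≤ tangleBound x :=
  mul_nonneg (sq_nonneg _) (pow_nonneg (sub_nonneg.2
    (Real.rpow_le_one (sq_nonneg _) (div_one_sub_sq_le_one hx) (by norm_num))) 3)

namespace Herm

/-- The 3-tangle is at most `tangleBound x` if the interference term is `x`. -/
theorem detForm_le {x : ℝ} (hx : x ≤ 1 / 2) {g h k : Herm} (hg : g.PSD) (hh : h.PSD) (hk : k.PSD)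
    (hJ : interf g h k = x * normForm g h k) :
    detForm g h k ≤ normForm g h k ^ 2 * tangleBound x := by
  have h1x : 0 < 1 - x := by linarith
  have hT := tangleBound_nonneg hx
  set s := g.1 * h.1 * k.1 with hs
  set r := g.2.1 * h.2.1 * k.2.1 with hr
  have hs0 : 0 ≤ s := mul_nonneg (mul_nonneg hg.1 hh.1) hk.1
  have hr0 : 0 ≤ r := mul_nonneg (mul_nonneg hg.2.1 hh.2.1) hk.2.1
  have hS : s + r = (1 - x) * normForm g h k := by
    rw [sub_mul, ← hJ, normForm, interf]; ring
  have hbig : 0 ≤ normForm g h k ^ 2 * tangleBound x := mul_nonneg (sq_nonneg _) hT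
  have hsr : s * r = (g.1 * g.2.1) * (h.1 * h.2.1) * (k.1 * k.2.1) := by rw [hs, hr]; ring
  have hdet : ∀ g : Herm, g.det ≤ g.1 * g.2.1 := fun g =>
    sub_le_self _ (Complex.normSq_nonneg _)
  -- If one product term vanishes, the determinant product, being at most s·r, vanishes too;
  -- otherwise the normalized squared overlaps are well defined.
  rcases (mul_nonneg hs0 hr0).eq_or_lt with h0 | h0
  · refine le_trans ?_ hbig
    have : g.det * h.det * k.det ≤ s * r := by
      rw [hsr]
      exact mul_le_mul (mul_le_mul (hdet g) (hdet h) hh.2.2 (mul_nonneg hg.1 hg.2.1)) (hdet k)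
        hk.2.2 (mul_nonneg (mul_nonneg hg.1 hg.2.1) (mul_nonneg hh.1 hh.2.1))
    rw [detForm]; linarith
  · have hfac : ∀ {g : Herm}, g.PSD → g.1 * g.2.1 ≠ 0 →
        0 ≤ Complex.normSq g.2.2 / (g.1 * g.2.1) ∧ Complex.normSq g.2.2 / (g.1 * g.2.1) ≤ 1 ∧
        g.det = g.1 * g.2.1 * (1 - Complex.normSq g.2.2 / (g.1 * g.2.1)) := by
      intro g hg h0
      have := mul_nonneg hg.1 hg.2.1
      refine ⟨div_nonneg (Complex.normSq_nonneg _) this, div_le_one_of_le₀ hg.normSq_le this, ?_⟩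
      rw [mul_sub, mul_div_cancel₀ _ h0, mul_one, det]
    have hne : g.1 * g.2.1 ≠ 0 ∧ h.1 * h.2.1 ≠ 0 ∧ k.1 * k.2.1 ≠ 0 := by
      rw [hsr] at h0
      refine ⟨?_, ?_, ?_⟩ <;> intro h <;> simp [h] at h0
    obtain ⟨a0, a1, ea⟩ := hfac hg hne.1
    obtain ⟨b0, b1, eb⟩ := hfac hh hne.2.1
    obtain ⟨c0, c1, ec⟩ := hfac hk hne.2.2
    set a := Complex.normSq g.2.2 / (g.1 * g.2.1)
    set b := Complex.normSq h.2.2 / (h.1 * h.2.1)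
    set c := Complex.normSq k.2.2 / (k.1 * k.2.1)
    -- A prescribed interference term forces large overlaps: the real part is at most the modulus,
    -- and 4sr ≤ (s + r)² with s + r = (1 - x)N.
    have habc : (x / (1 - x)) ^ 2 ≤ a * b * c := by
      have e1 : a * b * c = Complex.normSq (g.2.2 * h.2.2 * k.2.2) / (s * r) := by
        rw [hsr, Complex.normSq_mul, Complex.normSq_mul, div_mul_div_comm, div_mul_div_comm]
      have e2 : (interf g h k) ^ 2 ≤ 4 * Complex.normSq (g.2.2 * h.2.2 * k.2.2) := by
        rw [interf, Complex.normSq_apply]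
        nlinarith [sq_nonneg (g.2.2 * h.2.2 * k.2.2).im]
      have e3 : 4 * (s * r) ≤ (s + r) ^ 2 := by nlinarith [sq_nonneg (s - r)]
      rw [e1, div_pow, div_le_div_iff₀ (by positivity) h0]
      rw [hJ] at e2
      have hN : 0 ≤ normForm g h k := normForm_nonneg hg hh hk
      have hNp : 0 < normForm g h k := by
        refine lt_of_le_of_ne hN fun h => ?_
        rw [← h, mul_zero] at hS
        nlinarith
      rw [hS] at e3
      have e5 := mul_le_mul_of_nonneg_left e3 (sq_nonneg x)
      have e6 := mul_le_mul_of_nonneg_left e2 (sq_nonneg (1 - x))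
      have e7 : 4 * (x ^ 2 * (s * r)) ≤
          4 * (Complex.normSq (g.2.2 * h.2.2 * k.2.2) * (1 - x) ^ 2) := by linarith
      linarith
    have hle := prod_one_sub_le a0 b0 c0 a1 b1 c1
    have habc1 : a * b * c ≤ 1 := mul_le_one₀ (mul_le_one₀ a1 b0 b1) c0 c1
    have hmono : (1 - (a * b * c) ^ (1 / 3 : ℝ)) ^ 3 ≤
        (1 - ((x / (1 - x)) ^ 2) ^ (1 / 3 : ℝ)) ^ 3 := by
      refine pow_le_pow_left₀ (sub_nonneg.2 (Real.rpow_le_one (by positivity) habc1 (by norm_num)))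
        (sub_le_sub_left (Real.rpow_le_rpow (sq_nonneg _) habc (by norm_num)) _) 3
    calc detForm g h k = 4 * (s * r) * ((1 - a) * (1 - b) * (1 - c)) := by
          rw [detForm, ea, eb, ec, hsr]; ring
      _ ≤ (s + r) ^ 2 * (1 - ((x / (1 - x)) ^ 2) ^ (1 / 3 : ℝ)) ^ 3 := by
          refine mul_le_mul (by nlinarith [sq_nonneg (s - r)]) (hle.trans hmono) ?_ (sq_nonneg _)
          exact mul_nonneg (mul_nonneg (sub_nonneg.2 a1) (sub_nonneg.2 b1)) (sub_nonneg.2 c1)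
      _ = _ := by rw [hS, tangleBound]; ring

/-! ### The potential and its superadditivity -/

/-- The norm-weighted bound `min (tangle / t) 1` on the conversion probability into a state with
3-tangle `t`. -/
noncomputable def tanglePot (t : ℝ) (g h k : Herm) : ℝ :=
  min (detForm g h k / (normForm g h k * t)) (normForm g h k)

/-- The deviation of the interference term from `x`, normalized to `1` at interference term `y`. -/
noncomputable def deviation (x y : ℝ) (g h k : Herm) : ℝ :=
  (interf g h k - x * normForm g h k) / (y - x)

open Classical in
/-- A potential that does not increase on average under local measurements: it combines the
conservation of the interference term, as long as this lies on the side of `y` of the threshold `x`,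
with the monotonicity of the 3-tangle. -/
noncomputable def potential (t m x y : ℝ) (g h k : Herm) : ℝ :=
  if 0 ≤ deviation x y g h k then
    min (m * normForm g h k + (1 - m) * deviation x y g h k) (tanglePot t g h k)
  else tanglePot t g h k

theorem potential_comm₁₂ (t m x y : ℝ) (g h k : Herm) :
    potential t m x y g h k = potential t m x y h g k := by
  unfold potential tanglePot deviation
  rw [normForm_comm₁₂ g h k, interf_comm₁₂ g h k, detForm_comm₁₂ g h k]

theorem potential_comm₁₃ (t m x y : ℝ) (g h k : Herm) :
    potential t m x y g h k = potential t m x y k h g := by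
  unfold potential tanglePot deviation
  rw [normForm_comm₁₃ g h k, interf_comm₁₃ g h k, detForm_comm₁₃ g h k]

theorem potential_le_tanglePot (t m x y : ℝ) (g h k : Herm) :
    potential t m x y g h k ≤ tanglePot t g h k := by
  rw [potential]
  split_ifs
  · exact min_le_right _ _
  · exact le_rfl

theorem tanglePot_nonneg {t : ℝ} (ht : 0 < t) {g h k : Herm} (hg : g.PSD) (hh : h.PSD)
    (hk : k.PSD) : 0 ≤ tanglePot t g h k :=
  le_min (div_nonneg (detForm_nonneg hg hh hk) (mul_nonneg (normForm_nonneg hg hh hk) ht.le))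
    (normForm_nonneg hg hh hk)

theorem potential_nonneg {t m : ℝ} (x y : ℝ) (ht : 0 < t) (hm : 0 ≤ m) (hm1 : m ≤ 1) {g h k : Herm}
    (hg : g.PSD) (hh : h.PSD) (hk : k.PSD) : 0 ≤ potential t m x y g h k := by
  rw [potential]
  split_ifs with hd
  · exact le_min (add_nonneg (mul_nonneg hm (normForm_nonneg hg hh hk))
      (mul_nonneg (sub_nonneg.2 hm1) hd)) (tanglePot_nonneg ht hg hh hk)
  · exact tanglePot_nonneg ht hg hh hk

/-- With `h` and `k` fixed, the first entry of the minimum is a nonnegative constant times det /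
norm, which is superadditive, and the second entry is additive; a minimum of superadditive functions
is superadditive. -/
theorem tanglePot_add_le {t : ℝ} (ht : 0 < t) {g g' h k : Herm} (hg : g.PSD) (hg' : g'.PSD)
    (hh : h.PSD) (hk : k.PSD) :
    tanglePot t g h k + tanglePot t g' h k ≤ tanglePot t (g + g') h k := by
  have key := det_div_normForm_add_le hg hg' hh hk
  have e : ∀ g : Herm, detForm g h k / (normForm g h k * t) =
      4 * (h.det * k.det) / t * (g.det / normForm g h k) := by
    intro g
    rw [detForm, div_mul_div_comm, mul_comm t]; congr 1; ring
  refine le_min ?_ ?_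
  · refine (add_le_add (min_le_left _ _) (min_le_left _ _)).trans ?_
    rw [e, e, e, ← mul_add]
    exact mul_le_mul_of_nonneg_left key (div_nonneg (mul_nonneg zero_le_four
      (mul_nonneg hh.2.2 hk.2.2)) ht.le)
  · rw [normForm_add]
    exact add_le_add (min_le_right _ _) (min_le_right _ _)

theorem tanglePot_smul {s : ℝ} (hs : 0 ≤ s) (t : ℝ) (g h k : Herm) :
    tanglePot t (s • g) h k = s * tanglePot t g h k := by
  rw [tanglePot, tanglePot, mul_min_of_nonneg _ _ hs, normForm_smul, detForm, det_smul, detForm]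
  congr 1
  rcases hs.eq_or_lt with rfl | h0
  · simp
  · rw [mul_assoc s, ← mul_div_mul_left _ (normForm g h k * t) h0.ne', ← mul_div_assoc]
    congr 1; ring

theorem deviation_add (x y : ℝ) (g g' h k : Herm) :
    deviation x y (g + g') h k = deviation x y g h k + deviation x y g' h k := by
  rw [deviation, deviation, deviation, normForm_add, interf_add]; ring

theorem deviation_smul (x y s : ℝ) (g h k : Herm) :
    deviation x y (s • g) h k = s * deviation x y g h k := by
  rw [deviation, deviation, normForm_smul, interf_smul]; ring

/-- At the threshold interference term the tangle potential is controlled by the maximal 3-tangle. -/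
theorem tanglePot_le_of_deviation_eq_zero {t x y : ℝ} (ht : 0 < t) (hx : x ≤ 1 / 2) (hxy : x ≠ y)
    {g h k : Herm} (hg : g.PSD) (hh : h.PSD) (hk : k.PSD) (hd : deviation x y g h k = 0) :
    tanglePot t g h k ≤ min (tangleBound x / t) 1 * normForm g h k := by
  have hN := normForm_nonneg hg hh hk
  have hJ : interf g h k = x * normForm g h k := by
    rcases div_eq_zero_iff.1 hd with h | h
    · exact sub_eq_zero.1 h
    · exact absurd (sub_eq_zero.1 h).symm hxy
  have hle := detForm_le hx hg hh hk hJ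
  rw [min_mul_of_nonneg _ _ hN, one_mul]
  refine min_le_min_right _ ?_
  rcases hN.eq_or_lt with h0 | h0
  · simp [← h0]
  · rw [div_mul_eq_mul_div, div_le_div_iff₀ (mul_pos h0 ht) ht]
    have := mul_le_mul_of_nonneg_right hle ht.le
    nlinarith

/-- Superadditivity of the potential in case only one of the two summands lies on the side of `y` of
the threshold. -/
theorem potential_add_le_of_crossing {t x y : ℝ} (ht : 0 < t) (hx : x ≤ 1 / 2) (hxy : x ≠ y)
    {m : ℝ} (hm : m = min (tangleBound x / t) 1) {g g' h k : Herm} (hg : g.PSD) (hg' : g'.PSD)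
    (hh : h.PSD) (hk : k.PSD) (hd : deviation x y g h k < 0)
    (hd' : 0 ≤ deviation x y (g + g') h k) :
    potential t m x y g h k + potential t m x y g' h k ≤
      m * normForm (g + g') h k + (1 - m) * deviation x y (g + g') h k := by
  rw [deviation_add] at hd' ⊢
  have hpos : 0 < deviation x y g' h k := by linarith
  set ρ := deviation x y g h k with hρ
  set ρ' := deviation x y g' h k with hρ'
  -- The portion of `g'` that moves `g` exactly to the threshold. The merged form `g + s • g'` is
  -- controlled by the maximal tangle at x, while the remaining share 1 - s of `g'` keeps its linear
  -- bound.
  set s := -ρ / ρ' with hs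
  have hs0 : 0 ≤ s := div_nonneg (by linarith) hpos.le
  have hs1 : s ≤ 1 := (div_le_one hpos).2 (by linarith)
  have hsρ : s * ρ' = -ρ := div_mul_cancel₀ _ hpos.ne'
  have h0 : deviation x y (g + s • g') h k = 0 := by
    rw [deviation_add, deviation_smul, ← hρ, ← hρ', hsρ]; ring
  have h1 := tanglePot_le_of_deviation_eq_zero ht hx hxy (hg.add (hg'.smul hs0)) hh hk h0
  have h2 := tanglePot_add_le ht hg (hg'.smul hs0) hh hk
  rw [← hm, normForm_add, normForm_smul] at h1
  rw [tanglePot_smul hs0] at h2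
  have h3 := potential_le_tanglePot t m x y g h k
  have h4 := mul_le_mul_of_nonneg_left (potential_le_tanglePot t m x y g' h k) hs0
  have h5 : potential t m x y g' h k ≤ m * normForm g' h k + (1 - m) * ρ' := by
    rw [potential, if_pos hpos.le]; exact min_le_left _ _
  have h6 := mul_le_mul_of_nonneg_left h5 (sub_nonneg.2 hs1)
  rw [normForm_add]
  have h7 : m * normForm g h k + m * (s * normForm g' h k) +
      (1 - s) * (m * normForm g' h k + (1 - m) * ρ') =
      m * (normForm g h k + normForm g' h k) + (1 - m) * (ρ + ρ') := by
    linear_combination (m - 1) * hsρ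
  linarith

/-- The tangle potential bounds the left side in every case. The linear part matters only if the sum
lies on the side of `y`: it is additive if both summands do too, and otherwise exactly one has
crossed the threshold. -/
theorem potential_add_le {t x y : ℝ} (ht : 0 < t) (hx : x ≤ 1 / 2) (hxy : x ≠ y)
    {m : ℝ} (hm : m = min (tangleBound x / t) 1) {g g' h k : Herm} (hg : g.PSD) (hg' : g'.PSD)
    (hh : h.PSD) (hk : k.PSD) :
    potential t m x y g h k + potential t m x y g' h k ≤ potential t m x y (g + g') h k := by
  have hD : potential t m x y g h k + potential t m x y g' h k ≤ tanglePot t (g + g') h k :=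
    (add_le_add (potential_le_tanglePot t m x y g h k)
      (potential_le_tanglePot t m x y g' h k)).trans (tanglePot_add_le ht hg hg' hh hk)
  conv_rhs => rw [potential]
  split_ifs with hd
  · refine le_min ?_ hD
    rcases lt_or_ge (deviation x y g h k) 0 with h1 | h1
    · exact potential_add_le_of_crossing ht hx hxy hm hg hg' hh hk h1 hd
    rcases lt_or_ge (deviation x y g' h k) 0 with h2 | h2
    · rw [add_comm g] at hd ⊢
      rw [add_comm (potential t m x y g h k)]
      exact potential_add_le_of_crossing ht hx hxy hm hg' hg hh hk h2 hd
    · rw [potential, if_pos h1, potential, if_pos h2, normForm_add, deviation_add]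
      refine (add_le_add (min_le_left _ _) (min_le_left _ _)).trans_eq ?_
      ring
  · exact hD

/-- Semidefiniteness of the partial sums is carried through the induction because superadditivity
requires it. -/
theorem sum_potential_le {t x y : ℝ} (ht : 0 < t) (hx : x ≤ 1 / 2) (hxy : x ≠ y)
    {m : ℝ} (hm : m = min (tangleBound x / t) 1) {h k : Herm} (hh : h.PSD) (hk : k.PSD)
    {ι : Type*} (s : Finset ι) (g : ι → Herm) (hg : ∀ i, (g i).PSD) :
    (∑ i ∈ s, g i).PSD ∧
      ∑ i ∈ s, potential t m x y (g i) h k ≤ potential t m x y (∑ i ∈ s, g i) h k := by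
  classical
  have hm0 : 0 ≤ m := hm ▸ le_min (div_nonneg (tangleBound_nonneg hx) ht.le) zero_le_one
  have hm1 : m ≤ 1 := hm ▸ min_le_right _ _
  induction s using Finset.induction_on with
  | empty => exact ⟨PSD.zero, by simpa using potential_nonneg x y ht hm0 hm1 PSD.zero hh hk⟩
  | insert i s hi ih =>
    rw [Finset.sum_insert hi, Finset.sum_insert hi]
    exact ⟨(hg i).add ih.1, (add_le_add_right ih.2 _).trans
      (potential_add_le ht hx hxy hm (hg i) ih.1 hh hk)⟩

end Herm

/-! ### States obtained from `|000⟩ + |111⟩` by local operators -/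

/-- The Gram data of the two columns of a matrix. -/
noncomputable def gram {a : ℕ} (A : Matrix (Fin a) (Fin 2) ℂ) : Herm :=
  (∑ i, ‖A i 0‖ ^ 2, ∑ i, ‖A i 1‖ ^ 2, ∑ i, (starRingEnd ℂ) (A i 0) * A i 1)

theorem gram_psd {a : ℕ} (A : Matrix (Fin a) (Fin 2) ℂ) : (gram A).PSD := by
  refine ⟨by simp only [gram]; positivity, by simp only [gram]; positivity, sub_nonneg.2 ?_⟩
  rw [Complex.normSq_eq_norm_sq]
  simp only [gram]
  refine le_trans (pow_le_pow_left₀ (norm_nonneg _) (norm_sum_le _ _) 2) ?_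
  simp only [norm_mul, RCLike.norm_conj]
  exact Finset.sum_mul_sq_le_sq_mul_sq _ _ _

theorem gram_eq_conjTranspose_mul {a : ℕ} (A : Matrix (Fin a) (Fin 2) ℂ) :
    gram A = ((A.conjTranspose * A) 0 0 |>.re, (A.conjTranspose * A) 1 1 |>.re,
      (A.conjTranspose * A) 0 1) := by
  simp only [gram, Matrix.mul_apply, Matrix.conjTranspose_apply, Complex.re_sum, Prod.mk.injEq]
  refine ⟨Finset.sum_congr rfl fun i _ => ?_, Finset.sum_congr rfl fun i _ => ?_, rfl⟩ <;>
  · rw [← Complex.normSq_eq_norm_sq, Complex.normSq_apply]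
    simp

/-- A complete measurement preserves the Gram data on average. -/
theorem sum_gram_mul {a n : ℕ} (d : Fin n → ℕ) (K : ∀ i, Matrix (Fin (d i)) (Fin a) ℂ)
    (hK : ∑ i, (K i).conjTranspose * K i = 1) (A : Matrix (Fin a) (Fin 2) ℂ) :
    ∑ i, gram (K i * A) = gram A := by
  have h : ∑ i, (K i * A).conjTranspose * (K i * A) = A.conjTranspose * A := by
    calc _ = ∑ i, A.conjTranspose * ((K i).conjTranspose * K i) * A := by
          simp only [Matrix.conjTranspose_mul, Matrix.mul_assoc]
      _ = _ := by rw [← Matrix.sum_mul, ← Matrix.mul_sum, hK, Matrix.mul_one]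
  simp only [gram_eq_conjTranspose_mul, ← h, Matrix.sum_apply, Complex.re_sum]
  refine Prod.ext ?_ (Prod.ext ?_ ?_) <;> simp [Prod.fst_sum, Prod.snd_sum]

theorem gram_det (A : Matrix (Fin 2) (Fin 2) ℂ) : (gram A).det = ‖A.det‖ ^ 2 := by
  rw [← Complex.normSq_eq_norm_sq, Matrix.det_fin_two]
  simp only [Herm.det, gram, Fin.sum_univ_two, ← Complex.normSq_eq_norm_sq, Complex.normSq_apply,
    Complex.add_re, Complex.add_im, Complex.sub_re, Complex.sub_im, Complex.mul_re, Complex.mul_im,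
    Complex.conj_re, Complex.conj_im]
  ring

theorem gram_smul {a : ℕ} (z : ℂ) (A : Matrix (Fin a) (Fin 2) ℂ) :
    gram (z • A) = (‖z‖ ^ 2) • gram A := by
  simp only [gram, Matrix.smul_apply, smul_eq_mul, norm_mul, mul_pow, ← Finset.mul_sum, map_mul,
    Prod.smul_mk, Complex.real_smul, Prod.mk.injEq, true_and]
  rw [Finset.mul_sum]
  refine Finset.sum_congr rfl fun i _ => ?_
  rw [Complex.ofReal_pow, ← Complex.conj_mul']
  ring

namespace TriState

/-- The product vector of three vectors of arbitrary dimensions. -/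
noncomputable def tensor {a b c : ℕ} (x : Fin a → ℂ) (y : Fin b → ℂ) (z : Fin c → ℂ) :
    TriState a b c :=
  WithLp.toLp 2 fun p => x p.1 * y p.2.1 * z p.2.2

theorem inner_tensor {a b c : ℕ} (x x' : Fin a → ℂ) (y y' : Fin b → ℂ) (z z' : Fin c → ℂ) :
    inner ℂ (tensor x y z) (tensor x' y' z') =
      (∑ i, (starRingEnd ℂ) (x i) * x' i) * (∑ i, (starRingEnd ℂ) (y i) * y' i) *
        ∑ i, (starRingEnd ℂ) (z i) * z' i := by
  rw [PiLp.inner_apply, Finset.sum_mul_sum, Finset.sum_mul]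
  simp only [Fintype.sum_prod_type, tensor]
  refine Finset.sum_congr rfl fun i _ => ?_
  rw [Finset.sum_mul_sum]
  refine Finset.sum_congr rfl fun j _ => Finset.sum_congr rfl fun k _ => ?_
  simp only [RCLike.inner_apply, map_mul]
  ring

/-- The image of `|000⟩ + |111⟩` under local operators. -/
noncomputable def localImage {a b c : ℕ} (A : Matrix (Fin a) (Fin 2) ℂ) (B : Matrix (Fin b) (Fin 2) ℂ)
    (C : Matrix (Fin c) (Fin 2) ℂ) : TriState a b c :=
  tensor (fun i => A i 0) (fun i => B i 0) (fun i => C i 0) +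
    tensor (fun i => A i 1) (fun i => B i 1) (fun i => C i 1)

theorem localImage_apply {a b c : ℕ} (A : Matrix (Fin a) (Fin 2) ℂ) (B : Matrix (Fin b) (Fin 2) ℂ)
    (C : Matrix (Fin c) (Fin 2) ℂ) (p : Fin a × Fin b × Fin c) :
    localImage A B C p = A p.1 0 * B p.2.1 0 * C p.2.2 0 + A p.1 1 * B p.2.1 1 * C p.2.2 1 := rfl

theorem norm_localImage_sq {a b c : ℕ} (A : Matrix (Fin a) (Fin 2) ℂ) (B : Matrix (Fin b) (Fin 2) ℂ)
    (C : Matrix (Fin c) (Fin 2) ℂ) :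
    ‖localImage A B C‖ ^ 2 = Herm.normForm (gram A) (gram B) (gram C) := by
  have hsq : ∀ {a b c : ℕ} (x : Fin a → ℂ) (y : Fin b → ℂ) (z : Fin c → ℂ),
      ‖tensor x y z‖ ^ 2 = (∑ i, ‖x i‖ ^ 2) * (∑ i, ‖y i‖ ^ 2) * ∑ i, ‖z i‖ ^ 2 := by
    intro a b c x y z
    have h : ((‖tensor x y z‖ ^ 2 : ℝ) : ℂ) =
        ((∑ i, ‖x i‖ ^ 2) * (∑ i, ‖y i‖ ^ 2) * ∑ i, ‖z i‖ ^ 2 : ℝ) := by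
      push_cast
      simp only [← Complex.conj_mul']
      rw [← inner_tensor, inner_self_eq_norm_sq_to_K]
      simp
    exact_mod_cast h
  rw [localImage, norm_add_sq (𝕜 := ℂ), inner_tensor, hsq, hsq, Herm.normForm]
  simp only [gram, RCLike.re_to_complex]
  ring

theorem actA_localImage {a b c d : ℕ} (K : Matrix (Fin d) (Fin a) ℂ) (A : Matrix (Fin a) (Fin 2) ℂ)
    (B : Matrix (Fin b) (Fin 2) ℂ) (C : Matrix (Fin c) (Fin 2) ℂ) :
    actA K (localImage A B C) = localImage (K * A) B C := by
  ext p
  simp only [actA, localImage_apply, Matrix.mul_apply, Finset.sum_mul, ← Finset.sum_add_distrib]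
  exact Finset.sum_congr rfl fun i _ => by ring

theorem actB_localImage {a b c d : ℕ} (K : Matrix (Fin d) (Fin b) ℂ) (A : Matrix (Fin a) (Fin 2) ℂ)
    (B : Matrix (Fin b) (Fin 2) ℂ) (C : Matrix (Fin c) (Fin 2) ℂ) :
    actB K (localImage A B C) = localImage A (K * B) C := by
  ext p
  simp only [actB, localImage_apply, Matrix.mul_apply, Finset.sum_mul, Finset.mul_sum,
    ← Finset.sum_add_distrib]
  exact Finset.sum_congr rfl fun i _ => by ring

theorem actC_localImage {a b c d : ℕ} (K : Matrix (Fin d) (Fin c) ℂ) (A : Matrix (Fin a) (Fin 2) ℂ)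
    (B : Matrix (Fin b) (Fin 2) ℂ) (C : Matrix (Fin c) (Fin 2) ℂ) :
    actC K (localImage A B C) = localImage A B (K * C) := by
  ext p
  simp only [actC, localImage_apply, Matrix.mul_apply, Finset.mul_sum, ← Finset.sum_add_distrib]
  exact Finset.sum_congr rfl fun i _ => by ring

theorem smul_localImage {a b c : ℕ} (z : ℂ) (A : Matrix (Fin a) (Fin 2) ℂ)
    (B : Matrix (Fin b) (Fin 2) ℂ) (C : Matrix (Fin c) (Fin 2) ℂ) :
    z • localImage A B C = localImage (z • A) B C := by
  ext p
  simp only [PiLp.smul_apply, localImage_apply, Matrix.smul_apply, smul_eq_mul]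
  ring

theorem tangle_smul (z : ℂ) (ψ : TriState 2 2 2) : tangle (z • ψ) = ‖z‖ ^ 4 * tangle ψ := by
  simp only [tangle, PiLp.smul_apply, smul_eq_mul]
  rw [← norm_pow, mul_left_comm ‖z ^ 4‖, ← norm_mul]
  congr 2
  ring

/-- Cayley's hyperdeterminant is a relative invariant: local matrices multiply it by the square of
each determinant, and it equals 1 at |000⟩ + |111⟩. -/
theorem tangle_localImage (A B C : Matrix (Fin 2) (Fin 2) ℂ) :
    tangle (localImage A B C) = Herm.detForm (gram A) (gram B) (gram C) := by
  rw [Herm.detForm, gram_det, gram_det, gram_det, ← mul_pow, ← mul_pow, ← norm_mul, ← norm_mul,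
    ← norm_pow]
  simp only [tangle, localImage_apply, Matrix.det_fin_two]
  congr 2
  ring

theorem isGHZDecomp_localImage {A B C : Matrix (Fin 2) (Fin 2) ℂ} (hA : A.det ≠ 0) (hB : B.det ≠ 0)
    (hC : C.det ≠ 0) : IsGHZDecomp (localImage A B C)
      (tensor (fun i => A i 0) (fun i => B i 0) (fun i => C i 0))
      (tensor (fun i => A i 1) (fun i => B i 1) (fun i => C i 1)) := by
  have key : ∀ {A : Matrix (Fin 2) (Fin 2) ℂ}, A.det ≠ 0 → LinearIndependent ℂ
      ![(WithLp.toLp 2 fun i => A i 0 : EuclideanSpace ℂ (Fin 2)), WithLp.toLp 2 fun i => A i 1] := by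
    intro A hA
    rw [LinearIndependent.pair_iff]
    intro s t h
    have h0 : s * A 0 0 + t * A 0 1 = 0 := by simpa using congrArg (fun v => v 0) h
    have h1 : s * A 1 0 + t * A 1 1 = 0 := by simpa using congrArg (fun v => v 1) h
    rw [Matrix.det_fin_two] at hA
    constructor
    · refine (mul_eq_zero.1 ?_).resolve_right hA
      linear_combination A 1 1 * h0 - A 0 1 * h1
    · refine (mul_eq_zero.1 ?_).resolve_right hA
      linear_combination A 0 0 * h1 - A 1 0 * h0
  exact ⟨_, _, _, _, _, _, key hA, key hB, key hC, rfl, rfl, rfl⟩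

theorem interference_localImage {A B C : Matrix (Fin 2) (Fin 2) ℂ} (hA : A.det ≠ 0)
    (hB : B.det ≠ 0) (hC : C.det ≠ 0) :
    interference (localImage A B C) = Herm.interf (gram A) (gram B) (gram C) := by
  rw [interference_eq (isGHZDecomp_localImage hA hB hC), inner_tensor]
  rfl

theorem IsGHZClass.exists_localImage {φ : TriState 2 2 2} (h : IsGHZClass φ) :
    ∃ A B C : Matrix (Fin 2) (Fin 2) ℂ, A.det ≠ 0 ∧ B.det ≠ 0 ∧ C.det ≠ 0 ∧
      φ = localImage A B C := by
  obtain ⟨u, v, a₁, a₂, b₁, b₂, c₁, c₂, ha, hb, hc, rfl, rfl, rfl⟩ := h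
  have key : ∀ {x y : EuclideanSpace ℂ (Fin 2)}, LinearIndependent ℂ ![x, y] →
      (Matrix.of fun i (j : Fin 2) => ![x i, y i] j).det ≠ 0 := by
    intro x y h
    rw [Matrix.det_fin_two]
    have := det_ne_zero_of_linearIndependent h
    simp only [Matrix.of_apply, Matrix.cons_val_zero, Matrix.cons_val_one]
    intro h0
    exact this (by linear_combination h0)
  refine ⟨_, _, _, key ha, key hb, key hc, ?_⟩
  ext p
  simp [localImage_apply, prodVec]

/-- Products of Kraus operators may be singular. At a nonzero multiple of the target, the positive
tangle restores invertibility, which is needed to identify `Herm.interf` with the intrinsic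
interference term. -/
theorem det_ne_zero_of_tangle_pos {A B C : Matrix (Fin 2) (Fin 2) ℂ}
    (h : 0 < tangle (localImage A B C)) : A.det ≠ 0 ∧ B.det ≠ 0 ∧ C.det ≠ 0 := by
  rw [tangle_localImage, Herm.detForm, gram_det, gram_det, gram_det] at h
  refine ⟨?_, ?_, ?_⟩ <;> intro h0 <;> simp [h0] at h

theorem IsGHZClass.tangle_pos {φ : TriState 2 2 2} (h : IsGHZClass φ) : 0 < tangle φ := by
  obtain ⟨A, B, C, hA, hB, hC, rfl⟩ := h.exists_localImage
  rw [tangle_localImage, Herm.detForm, gram_det, gram_det, gram_det]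
  positivity

/-! ### The potential along an LOCC protocol -/

/-- The potential is at least the squared norm at multiples of the target. -/
theorem norm_sq_le_potential {φ : TriState 2 2 2} (hφ : ‖φ‖ = 1) (hcl : IsGHZClass φ) {m x : ℝ}
    (hm : 0 ≤ m) (hm1 : m ≤ 1) (hx : x ≠ interference φ) {A B C : Matrix (Fin 2) (Fin 2) ℂ} {z : ℂ}
    (h : localImage A B C = z • φ) :
    ‖localImage A B C‖ ^ 2 ≤
      Herm.potential (tangle φ) m x (interference φ) (gram A) (gram B) (gram C) := by
  have ht := hcl.tangle_pos
  rcases eq_or_ne z 0 with rfl | hz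
  · rw [h, zero_smul, norm_zero]
    simpa using Herm.potential_nonneg x (interference φ) ht hm hm1 (gram_psd A) (gram_psd B)
      (gram_psd C)
  have hzp : 0 < ‖z‖ := norm_pos_iff.2 hz
  have hT : tangle (localImage A B C) = ‖z‖ ^ 4 * tangle φ := by rw [h, tangle_smul]
  have hN : ‖localImage A B C‖ ^ 2 = ‖z‖ ^ 2 := by rw [h, norm_smul, hφ, mul_one]
  obtain ⟨hA, hB, hC⟩ := det_ne_zero_of_tangle_pos
    (hT.symm ▸ mul_pos (pow_pos hzp 4) ht : 0 < tangle (localImage A B C))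
  obtain ⟨A', B', C', hA', hB', hC', rfl⟩ := hcl.exists_localImage
  -- The matrices of the branch and of the target may differ; the two interference terms agree up to
  -- scale because the interference term does not depend on the decomposition.
  have hJ : Herm.interf (gram A) (gram B) (gram C) =
      ‖z‖ ^ 2 * interference (localImage A' B' C') := by
    rw [← interference_localImage hA hB hC, h, smul_localImage, interference_localImage _ hB' hC',
      gram_smul, Herm.interf_smul, interference_localImage hA' hB' hC']
    rw [Matrix.det_smul]
    exact mul_ne_zero (pow_ne_zero _ hz) hA'
  rw [tangle_localImage A B C] at hT
  rw [hN]
  rw [norm_localImage_sq] at hN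
  have hd : Herm.deviation x (interference (localImage A' B' C')) (gram A) (gram B) (gram C) =
      ‖z‖ ^ 2 := by
    rw [Herm.deviation, hJ, hN, mul_comm x, ← mul_sub,
      mul_div_cancel_right₀ _ (sub_ne_zero.2 hx.symm)]
  have htp : Herm.tanglePot (tangle (localImage A' B' C')) (gram A) (gram B) (gram C) = ‖z‖ ^ 2 := by
    rw [Herm.tanglePot, hT, hN, mul_div_mul_right _ _ ht.ne', min_eq_right_iff, le_div_iff₀]
    · exact le_of_eq (by ring)
    · positivity
  rw [Herm.potential, hd, if_pos (by positivity), htp, hN]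
  exact le_min (le_of_eq (by ring)) le_rfl

end TriState

/-- Induction on the protocol. One round writes the acting party's Gram form as the sum of those of
its branches, so superadditivity gives the step; the symmetry of the potential moves Bob's or
Charlie's form to the first argument. -/
theorem LOCC.successProb_le_potential {φ : TriState 2 2 2} (hφ : ‖φ‖ = 1) (hcl : IsGHZClass φ)
    {x m : ℝ} (hx : x ≤ 1 / 2) (hxφ : x ≠ interference φ)
    (hm : m = min (tangleBound x / tangle φ) 1) {a b c : ℕ} (P : LOCC a b c) :
    ∀ (A : Matrix (Fin a) (Fin 2) ℂ) (B : Matrix (Fin b) (Fin 2) ℂ) (C : Matrix (Fin c) (Fin 2) ℂ),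
      P.successProb φ (localImage A B C) ≤
        Herm.potential (tangle φ) m x (interference φ) (gram A) (gram B) (gram C) := by
  have ht := hcl.tangle_pos
  have hm0 : 0 ≤ m := hm ▸ le_min (div_nonneg (tangleBound_nonneg hx) ht.le) zero_le_one
  have hm1 : m ≤ 1 := hm ▸ min_le_right _ _
  induction P with
  | done =>
    intro A B C
    rw [LOCC.successProb]
    split_ifs with h
    · obtain ⟨z, hz⟩ := h
      exact norm_sq_le_potential hφ hcl hm0 hm1 hxφ hz
    · exact Herm.potential_nonneg x _ ht hm0 hm1 (gram_psd A) (gram_psd B) (gram_psd C)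
  | alice d K complete next ih =>
    intro A B C
    simp only [LOCC.successProb, actA_localImage]
    refine (Finset.sum_le_sum fun i _ => ih i (K i * A) B C).trans ?_
    rw [← sum_gram_mul d K complete A]
    exact (Herm.sum_potential_le ht hx hxφ hm (gram_psd B) (gram_psd C) _ _
      fun i => gram_psd (K i * A)).2
  | bob d K complete next ih =>
    intro A B C
    simp only [LOCC.successProb, actB_localImage]
    refine (Finset.sum_le_sum fun i _ => ih i A (K i * B) C).trans ?_
    rw [← sum_gram_mul d K complete B]
    simp only [Herm.potential_comm₁₂ _ _ _ _ (gram A)]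
    exact (Herm.sum_potential_le ht hx hxφ hm (gram_psd A) (gram_psd C) _ _
      fun i => gram_psd (K i * B)).2
  | charlie d K complete next ih =>
    intro A B C
    simp only [LOCC.successProb, actC_localImage]
    refine (Finset.sum_le_sum fun i _ => ih i A B (K i * C)).trans ?_
    rw [← sum_gram_mul d K complete C]
    simp only [Herm.potential_comm₁₃ _ _ _ _ (gram A)]
    exact (Herm.sum_potential_le ht hx hxφ hm (gram_psd B) (gram_psd A) _ _
      fun i => gram_psd (K i * C)).2

/-! ### The maximal 3-tangle -/

namespace TriState

theorem interference_le_half {ψ : TriState 2 2 2} (hψ : ‖ψ‖ = 1) (h : IsGHZClass ψ) :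
    interference ψ ≤ 1 / 2 := by
  obtain ⟨A, B, C, hA, hB, hC, rfl⟩ := h.exists_localImage
  rw [interference_localImage hA hB hC]
  have h1 : Herm.normForm (gram A) (gram B) (gram C) = 1 := by
    rw [← norm_localImage_sq, hψ, one_pow]
  have h2 := (abs_le.1 (Herm.abs_interf_le (gram_psd A) (gram_psd B) (gram_psd C))).2
  rw [Herm.normForm] at h1
  rw [Herm.interf] at h2 ⊢
  linarith

theorem tangle_le_tangleBound {φ : TriState 2 2 2} (hφ : ‖φ‖ = 1) (h : IsGHZClass φ) :
    tangle φ ≤ tangleBound (interference φ) := by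
  have hx := interference_le_half hφ h
  obtain ⟨A, B, C, hA, hB, hC, rfl⟩ := h.exists_localImage
  have h1 : Herm.normForm (gram A) (gram B) (gram C) = 1 := by
    rw [← norm_localImage_sq, hφ, one_pow]
  have := Herm.detForm_le hx (gram_psd A) (gram_psd B) (gram_psd C)
    (by rw [h1, mul_one, interference_localImage hA hB hC])
  rwa [h1, one_pow, one_mul, ← tangle_localImage] at this

/-- The local operator that turns `|0⟩` and `|1⟩` into vectors with overlap `g`. -/
noncomputable def overlapMatrix (g : ℝ) : Matrix (Fin 2) (Fin 2) ℂ :=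
  !![1, (g : ℂ); 0, (√(1 - g ^ 2) : ℝ)]

theorem target_eq_localImage (g : ℝ) : target g =
    localImage (((1 / √(2 + 2 * g ^ 3) : ℝ) : ℂ) • overlapMatrix g) (overlapMatrix g)
      (overlapMatrix g) := by
  rw [target, ← smul_localImage]
  congr 1
  ext ⟨i, j, k⟩
  fin_cases i <;> fin_cases j <;> fin_cases k <;>
    simp [prodVec, localImage_apply, overlapMatrix]

theorem one_sub_sq_pos {g : ℝ} (h1 : -1 < g) (h2 : g < 1) : 0 < 1 - g ^ 2 := by nlinarith

theorem one_add_cube_pos {g : ℝ} (h1 : -1 < g) : 0 < 1 + g ^ 3 := by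
  nlinarith [mul_pos (by linarith : 0 < 1 + g) (by nlinarith [sq_nonneg (g - 1 / 2)] :
    0 < 1 - g + g ^ 2)]

theorem gram_overlapMatrix {g : ℝ} (h1 : -1 < g) (h2 : g < 1) :
    gram (overlapMatrix g) = (1, 1, (g : ℂ)) := by
  have h := Real.sq_sqrt (one_sub_sq_pos h1 h2).le
  simp [gram, overlapMatrix, h]

theorem det_overlapMatrix_ne_zero {g : ℝ} (h1 : -1 < g) (h2 : g < 1) :
    (overlapMatrix g).det ≠ 0 := by
  rw [overlapMatrix, Matrix.det_fin_two_of]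
  simpa using (Real.sqrt_pos.2 (one_sub_sq_pos h1 h2)).ne'

theorem target_scale_sq {g : ℝ} (h1 : -1 < g) :
    ‖((1 / √(2 + 2 * g ^ 3) : ℝ) : ℂ)‖ ^ 2 = 1 / (2 + 2 * g ^ 3) := by
  have := one_add_cube_pos h1
  rw [Complex.norm_real, Real.norm_eq_abs, sq_abs, div_pow, one_pow, Real.sq_sqrt (by linarith)]

theorem norm_target {g : ℝ} (h1 : -1 < g) (h2 : g < 1) : ‖target g‖ = 1 := by
  have h3 := one_add_cube_pos h1
  have : ‖target g‖ ^ 2 = 1 := by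
    rw [target_eq_localImage, norm_localImage_sq, gram_smul, target_scale_sq h1,
      Herm.normForm_smul, gram_overlapMatrix h1 h2, Herm.normForm, ← Complex.ofReal_mul,
      ← Complex.ofReal_mul, Complex.ofReal_re, div_mul_eq_mul_div, div_eq_one_iff_eq (by linarith)]
    ring
  exact (pow_eq_one_iff_of_nonneg (norm_nonneg _) two_ne_zero).1 this

theorem det_smul_overlapMatrix_ne_zero {g : ℝ} (h1 : -1 < g) (h2 : g < 1) :
    (((1 / √(2 + 2 * g ^ 3) : ℝ) : ℂ) • overlapMatrix g).det ≠ 0 := by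
  have h3 := one_add_cube_pos h1
  rw [Matrix.det_smul]
  refine mul_ne_zero (pow_ne_zero _ (Complex.ofReal_ne_zero.2 ?_)) (det_overlapMatrix_ne_zero h1 h2)
  exact (one_div_pos.2 (Real.sqrt_pos.2 (by linarith))).ne'

theorem isGHZClass_target {g : ℝ} (h1 : -1 < g) (h2 : g < 1) : IsGHZClass (target g) := by
  rw [target_eq_localImage]
  exact ⟨_, _, isGHZDecomp_localImage (det_smul_overlapMatrix_ne_zero h1 h2)
    (det_overlapMatrix_ne_zero h1 h2) (det_overlapMatrix_ne_zero h1 h2)⟩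

theorem interference_target {g : ℝ} (h1 : -1 < g) (h2 : g < 1) :
    interference (target g) = g ^ 3 / (1 + g ^ 3) := by
  have h3 := one_add_cube_pos h1
  rw [target_eq_localImage, interference_localImage (det_smul_overlapMatrix_ne_zero h1 h2)
    (det_overlapMatrix_ne_zero h1 h2) (det_overlapMatrix_ne_zero h1 h2), gram_smul,
    target_scale_sq h1, Herm.interf_smul, gram_overlapMatrix h1 h2, Herm.interf,
    ← Complex.ofReal_mul, ← Complex.ofReal_mul, Complex.ofReal_re, div_mul_eq_mul_div,
    div_eq_div_iff (by linarith) h3.ne']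
  ring

theorem tangle_target {g : ℝ} (h1 : -1 < g) (h2 : g < 1) :
    tangle (target g) = (1 - g ^ 2) ^ 3 / (1 + g ^ 3) ^ 2 := by
  have h3 := one_add_cube_pos h1
  rw [target_eq_localImage, tangle_localImage, gram_smul, target_scale_sq h1, Herm.detForm,
    Herm.det_smul, gram_overlapMatrix h1 h2, Herm.det, Complex.normSq_ofReal]
  have : (2 + 2 * g ^ 3) ≠ 0 := by linarith
  field_simp
  ring

/-- Real equal overlaps g for all parties and two terms of equal norm give equality in both Hölder
and AM–GM, so the symmetric states `target g`, with g possibly negative, attain the bound. -/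
theorem isGreatest_tangleBound {x : ℝ} (hx : x < 1 / 2) :
    IsGreatest (tangleSet x) (tangleBound x) := by
  constructor
  · have h1x : 0 < 1 - x := by linarith
    -- `target g` has interference term g³/(1 + g³), so g³ must be x/(1 - x), which lies strictly
    -- between -1 and 1 for x < 1/2.
    obtain ⟨g, ⟨hg1, hg2⟩, hg⟩ := intermediate_value_Icc (f := fun g : ℝ => g ^ 3)
      (by norm_num : (-1 : ℝ) ≤ 1) (by fun_prop) (show x / (1 - x) ∈ _ by
        constructor
        · norm_num; rw [le_div_iff₀ h1x]; linarith
        · norm_num; rw [div_le_one h1x]; linarith)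
    simp only at hg
    have hg1' : -1 < g := lt_of_le_of_ne hg1 (by
      rintro rfl
      rw [eq_div_iff h1x.ne'] at hg; linarith)
    have hg2' : g < 1 := lt_of_le_of_ne hg2 (by
      rintro rfl
      rw [eq_div_iff h1x.ne'] at hg; linarith)
    have h1g : 1 + g ^ 3 = 1 / (1 - x) := by rw [hg]; field_simp; ring
    refine ⟨target g, norm_target hg1' hg2', isGHZClass_target hg1' hg2', ?_, ?_⟩
    · rw [interference_target hg1' hg2', h1g, hg]; field_simp
    · rw [tangle_target hg1' hg2', tangleBound, h1g, ← hg]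
      have : ((g ^ 3) ^ 2) ^ (1 / 3 : ℝ) = g ^ 2 := by
        rw [← pow_mul, mul_comm 3, pow_mul, ← Real.rpow_natCast (g ^ 2) 3,
          ← Real.rpow_mul (sq_nonneg g)]
        norm_num
      rw [this]
      field_simp
  · rintro _ ⟨φ, h1, h2, rfl, rfl⟩
    exact tangle_le_tangleBound h1 h2

theorem maxTangle_eq {x : ℝ} (hx : x ≤ 1 / 2) : maxTangle x = tangleBound x := by
  rcases hx.eq_or_lt with rfl | hx
  -- At 1/2 the bound vanishes while GHZ-class states have positive tangle; the set is therefore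
  -- empty and its `sSup` is the default value 0.
  · have h0 : tangleBound (1 / 2) = 0 := by norm_num [tangleBound]
    have : tangleSet (1 / 2) = ∅ := by
      refine Set.eq_empty_of_forall_notMem ?_
      rintro _ ⟨φ, h1, h2, h3, rfl⟩
      have := tangle_le_tangleBound h1 h2
      rw [h3, h0] at this
      exact this.not_gt h2.tangle_pos
    rw [maxTangle, this, Real.sSup_empty, h0]
  · exact (isGreatest_tangleBound hx).csSup_eq

theorem ghz_eq_target : ghz = target 0 := by
  simp [ghz, target]

/-! ### The bound on the conversion probability -/

theorem pMax_eq (φ : TriState 2 2 2) {x : ℝ} (hx : x ≤ 1 / 2) :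
    pMax φ x = min (tangleBound x / tangle φ) 1 := by rw [pMax, maxTangle_eq hx]

theorem pMax_nonneg {φ : TriState 2 2 2} (hφ : IsGHZClass φ) {x : ℝ} (hx : x ≤ 1 / 2) :
    0 ≤ pMax φ x := by
  rw [pMax_eq φ hx]
  exact le_min (div_nonneg (tangleBound_nonneg hx) hφ.tangle_pos.le) zero_le_one

/-- A nonnegative `pAlready` says that ψ lies on the φ-side of the threshold. There `pAlready` is
the deviation of ψ, and the linear part of the potential equals `pBar`. -/
theorem optProb_le_pBar {ψ φ : TriState 2 2 2} (hψ : ‖ψ‖ = 1) (hφ : ‖φ‖ = 1) (hψc : IsGHZClass ψ)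
    (hφc : IsGHZClass φ) {x : ℝ} (hx : x ≤ 1 / 2) (hxφ : x ≠ interference φ)
    (h0 : 0 ≤ pAlready ψ φ x) : optProb ψ φ ≤ pBar ψ φ x := by
  obtain ⟨A, B, C, hA, hB, hC, rfl⟩ := hψc.exists_localImage
  have : Nonempty (LOCC 2 2 2) := ⟨.done⟩
  refine csSup_le (Set.range_nonempty _) ?_
  rintro _ ⟨P, rfl⟩
  refine (P.successProb_le_potential hφ hφc hx hxφ rfl A B C).trans ?_
  have hN : Herm.normForm (gram A) (gram B) (gram C) = 1 := by
    rw [← norm_localImage_sq, hψ, one_pow]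
  have hd : Herm.deviation x (interference φ) (gram A) (gram B) (gram C) =
      pAlready (localImage A B C) φ x := by
    rw [Herm.deviation, hN, pAlready, interference_localImage hA hB hC, mul_one]
  rw [Herm.potential, hd, if_pos h0]
  refine (min_le_left _ _).trans_eq ?_
  rw [hN, pBar, pMax_eq φ hx]
  ring

/-! ### Existence of the minima -/

theorem continuousOn_tangleBound : ContinuousOn tangleBound (Set.Iic (1 / 2)) := by
  have h : ContinuousOn (fun x : ℝ => (x / (1 - x)) ^ 2) (Set.Iic (1 / 2)) := by
    refine (continuousOn_id.div (by fun_prop) fun x hx => ?_).pow 2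
    have : x ≤ 1 / 2 := hx
    linarith
  have h2 := h.rpow_const (p := 1 / 3) fun x _ => Or.inr (by norm_num)
  exact ((continuousOn_const.sub continuousOn_id).pow 2).mul ((continuousOn_const.sub h2).pow 3)

theorem continuousOn_pBar (ψ φ : TriState 2 2 2) {s : Set ℝ} (hs : s ⊆ Set.Iic (1 / 2))
    (hφ : interference φ ∉ s) : ContinuousOn (pBar ψ φ) s := by
  have h1 : ContinuousOn (pMax φ) s := by
    refine ContinuousOn.congr ?_ fun x hx => pMax_eq φ (hs hx)
    exact ContinuousOn.inf ((continuousOn_tangleBound.mono hs).div_const _) continuousOn_const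
  have h2 : ContinuousOn (pAlready ψ φ) s :=
    ContinuousOn.div (by fun_prop) (by fun_prop) fun x hx h =>
      hφ (by rwa [sub_eq_zero.1 h])
  exact h2.add ((continuousOn_const.sub h2).mul h1)

theorem pBar_eq_one_sub (ψ φ : TriState 2 2 2) (x : ℝ) :
    pBar ψ φ x = 1 - (1 - pAlready ψ φ x) * (1 - pMax φ x) := by rw [pBar]; ring

theorem one_sub_pAlready {ψ φ : TriState 2 2 2} {x : ℝ} (hx : x ≠ interference φ) :
    1 - pAlready ψ φ x = (interference φ - interference ψ) / (interference φ - x) := by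
  rw [pAlready, one_sub_div (sub_ne_zero.2 hx.symm)]
  ring

/-- As the threshold tends to `-∞`, the bound tends to `1`, which it never exceeds; hence it has a
minimum. -/
theorem exists_isLeast_pBar_Iic {ψ φ : TriState 2 2 2} (hψ : interference ψ ≤ 1 / 2)
    (hφ : IsGHZClass φ) (h : interference ψ < interference φ) :
    ∃ m, IsLeast (pBar ψ φ '' Set.Iic (interference ψ)) m := by
  set a := interference ψ with ha
  set b := interference φ with hb
  have hlow : ∀ x ≤ a, 1 - (b - a) / (b - x) ≤ pBar ψ φ x := by
    intro x hx
    have hp := pMax_nonneg hφ (hx.trans hψ)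
    have : 0 ≤ (b - a) / (b - x) := div_nonneg (by linarith) (by linarith)
    rw [pBar_eq_one_sub, one_sub_pAlready (by linarith : x < interference φ).ne, ← ha, ← hb]
    nlinarith
  have hup : ∀ x ≤ a, pBar ψ φ x ≤ 1 := by
    intro x hx
    have hp : pMax φ x ≤ 1 := min_le_right _ _
    have : 0 ≤ (b - a) / (b - x) := div_nonneg (by linarith) (by linarith)
    rw [pBar_eq_one_sub, one_sub_pAlready (by linarith : x < interference φ).ne, ← ha, ← hb]
    nlinarith
  -- Either the bound is identically 1, or some value lies below 1 and the limit 1 at -∞ confines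
  -- the search to a compact interval.
  by_cases hall : ∀ x ≤ a, 1 ≤ pBar ψ φ x
  · refine ⟨pBar ψ φ a, Set.mem_image_of_mem _ Set.self_mem_Iic, ?_⟩
    rintro _ ⟨x, hx, rfl⟩
    exact (hup a le_rfl).trans (hall x hx)
  · push Not at hall
    obtain ⟨x₀, hx₀, h1⟩ := hall
    set δ := 1 - pBar ψ φ x₀ with hδ
    have hδ0 : 0 < δ := by linarith
    -- Left of R the lower bound `hlow` already exceeds the value at `x₀`, since (b - a)/(b - x) ≤ δ
    -- there.
    set R := min x₀ (b - (b - a) / δ)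
    have hsub : Set.Icc R a ⊆ Set.Iic a := fun x hx => hx.2
    have hcont : ContinuousOn (pBar ψ φ) (Set.Icc R a) := continuousOn_pBar ψ φ
      (fun x hx => hx.2.trans hψ) fun hx => (hx.2.trans_lt h).false
    obtain ⟨y, hy, hmin⟩ := isCompact_Icc.exists_isMinOn ⟨x₀, min_le_left _ _, hx₀⟩ hcont
    refine ⟨pBar ψ φ y, Set.mem_image_of_mem _ (hsub hy), ?_⟩
    rintro _ ⟨x, hx, rfl⟩
    rcases le_or_gt R x with hR | hR
    · exact hmin ⟨hR, hx⟩
    · refine (hmin (show x₀ ∈ _ from ⟨min_le_left _ _, hx₀⟩)).trans (le_trans ?_ (hlow x hx))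
      have hx' : x < a := lt_of_lt_of_le hR ((min_le_left _ _).trans hx₀)
      have h2 : (b - a) / δ ≤ b - x := by
        have := hR.le.trans (min_le_right _ _); linarith
      have h3 : (b - a) / (b - x) ≤ δ := by
        rw [div_le_iff₀ hδ0] at h2
        rw [div_le_iff₀ (by linarith)]
        linarith
      show pBar ψ φ x₀ ≤ _
      linarith

theorem exists_isLeast_pBar_Icc {ψ φ : TriState 2 2 2} (hψ : interference ψ ≤ 1 / 2)
    (h : interference φ < interference ψ) :
    ∃ m, IsLeast (pBar ψ φ '' Set.Icc (interference ψ) (1 / 2)) m :=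
  (isCompact_Icc.image_of_continuousOn (continuousOn_pBar ψ φ (fun _ hx => hx.2)
    fun hx => (h.trans_le hx.1).false)).exists_isLeast ⟨_, Set.mem_image_of_mem _ ⟨le_rfl, hψ⟩⟩

/-! ### Transformations from the GHZ state -/

theorem interference_ghz : interference ghz = 0 := by
  rw [ghz_eq_target, interference_target (by norm_num) (by norm_num)]; norm_num

theorem norm_ghz : ‖ghz‖ = 1 := by
  rw [ghz_eq_target, norm_target (by norm_num) (by norm_num)]

theorem isGHZClass_ghz : IsGHZClass ghz := by
  rw [ghz_eq_target]; exact isGHZClass_target (by norm_num) (by norm_num)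

/-- Since q = z/(1 + z) lies in [0, 1], q^(2/3) ≥ q. The resulting decay makes `pMax` drop below 1
for large z, so the minimum of `pBar` is strictly below 1. -/
theorem tangleBound_neg_le {z : ℝ} (hz : 0 ≤ z) : tangleBound (-z) ≤ 1 / (1 + z) := by
  have h1 : 0 < 1 + z := by linarith
  have hq0 : 0 ≤ z / (1 + z) := by positivity
  have hq1 : z / (1 + z) ≤ 1 := by rw [div_le_one h1]; linarith
  have e : (-z / (1 - -z)) ^ 2 = (z / (1 + z)) ^ 2 := by
    rw [sub_neg_eq_add, neg_div, neg_sq]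
  have h2 : z / (1 + z) ≤ ((z / (1 + z)) ^ 2) ^ (1 / 3 : ℝ) := by
    rw [← Real.rpow_natCast, ← Real.rpow_mul hq0]
    exact Real.self_le_rpow_of_le_one hq0 hq1 (by norm_num)
  have h3 : ((z / (1 + z)) ^ 2) ^ (1 / 3 : ℝ) ≤ 1 :=
    Real.rpow_le_one (sq_nonneg _) (pow_le_one₀ hq0 hq1) (by norm_num)
  rw [tangleBound, e, sub_neg_eq_add]
  have h4 : (1 - ((z / (1 + z)) ^ 2) ^ (1 / 3 : ℝ)) ^ 3 ≤ (1 / (1 + z)) ^ 3 := by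
    refine pow_le_pow_left₀ (sub_nonneg.2 h3) ?_ 3
    rw [show 1 / (1 + z) = 1 - z / (1 + z) by field_simp; ring]
    linarith
  calc _ ≤ (1 + z) ^ 2 * (1 / (1 + z)) ^ 3 := mul_le_mul_of_nonneg_left h4 (sq_nonneg _)
    _ = _ := by field_simp

/-- For protocols from the GHZ state, the maximum of `pBound` is the minimum of `pBar`. -/
theorem pBound_isGreatest {φ : TriState 2 2 2} (hφ : IsGHZClass φ) (hb : 0 < interference φ) {m : ℝ}
    (hm : IsLeast ((fun x => pBar ghz φ (-x)) '' Set.Ici 0) m) :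
    IsGreatest (pBound φ '' Set.Ici 0) m := by
  set b := interference φ with hbdef
  have hpA : ∀ z : ℝ, pAlready ghz φ (-z) = z / (b + z) := by
    intro z; rw [pAlready, interference_ghz]; congr 1 <;> ring
  have h1sub : ∀ z : ℝ, 0 ≤ z → 1 - pAlready ghz φ (-z) = b / (b + z) := by
    intro z hz
    rw [hpA, one_sub_div (by linarith)]; congr 1; ring
  have hpU : ∀ z : ℝ, 0 ≤ z → pU φ z ≤ pBar ghz φ (-z) := by
    intro z hz
    have hp := pMax_nonneg hφ (by linarith : -z ≤ 1 / 2)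
    rw [pBar, h1sub z hz, hpA, pU, ← hbdef]
    have := mul_nonneg (div_nonneg hb.le (by linarith : 0 ≤ b + z)) hp
    linarith
  have hbelow : ∀ z : ℝ, BddBelow ((fun x => pBar ghz φ (-x)) '' Set.Icc 0 z) := fun z =>
    ⟨m, by rintro _ ⟨x, hx, rfl⟩; exact hm.2 ⟨x, hx.1, rfl⟩⟩
  have hm1 : m < 1 := by
    have ht := hφ.tangle_pos
    have hz : 0 ≤ 1 / tangle φ := by positivity
    -- At z = 1/τ(φ) the decay estimate gives T(-z) ≤ τ/(1 + τ) < τ.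
    refine (hm.2 ⟨1 / tangle φ, hz, rfl⟩).trans_lt ?_
    have hp : pMax φ (-(1 / tangle φ)) < 1 := by
      rw [pMax_eq φ (by linarith)]
      refine (min_le_left _ _).trans_lt ((div_lt_one ht).2 ((tangleBound_neg_le hz).trans_lt ?_))
      rw [div_lt_iff₀ (by positivity), mul_add, mul_one_div_cancel ht.ne']
      linarith
    simp only [pBar_eq_one_sub, h1sub _ hz]
    have := mul_pos (div_pos hb (by linarith : 0 < b + 1 / tangle φ)) (sub_pos.2 hp)
    linarith
  have hle : ∀ z : ℝ, 0 ≤ z → pBound φ z ≤ m := by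
    intro z hz
    obtain ⟨w, hw, hwm⟩ := hm.1
    have hw0 : 0 ≤ w := hw
    -- Beyond the minimizer w, the minimum over [0, z] has reached m; before it, monotonicity gives
    -- `pU` at z ≤ `pU` at w ≤ `pBar` at -w = m.
    rcases le_or_gt w z with h | h
    · exact (min_le_right _ _).trans ((csInf_le (hbelow z) ⟨w, ⟨hw, h⟩, rfl⟩).trans_eq hwm)
    · refine (min_le_left _ _).trans (le_trans ?_ ((hpU w hw).trans_eq hwm))
      rw [pU, pU, div_le_div_iff₀ (by linarith) (by linarith)]
      nlinarith
  -- `pU` reaches m at z = bm/(1 - m), so b/(1 - m) is large enough: there `pU` equals 1/(2 - m) ≥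
  -- m, as (1 - m)² ≥ 0. The other term is never below m.
  refine ⟨⟨b / (1 - m), div_nonneg hb.le (by linarith), ?_⟩, ?_⟩
  · have h1m : 0 < 1 - m := by linarith
    have hz : 0 ≤ b / (1 - m) := div_nonneg hb.le h1m.le
    refine le_antisymm (hle _ hz) (le_min ?_ ?_)
    · rw [pU, ← hbdef, show b / (1 - m) / (b + b / (1 - m)) = 1 / (2 - m) by
        have : 2 - m ≠ 0 := by linarith
        have : 1 - m + 1 ≠ 0 := by linarith
        field_simp
        ring, le_div_iff₀ (by linarith)]
      nlinarith [sq_nonneg (1 - m)]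
    · refine le_csInf ⟨_, Set.mem_image_of_mem _ ⟨le_rfl, hz⟩⟩ ?_
      rintro _ ⟨x, hx, rfl⟩
      exact hm.2 ⟨x, hx.1, rfl⟩
  · rintro _ ⟨z, hz, rfl⟩
    exact hle z hz

theorem exists_isLeast_pBar_of_lt {ψ φ : TriState 2 2 2} (hψ : ‖ψ‖ = 1) (hφ : ‖φ‖ = 1)
    (hψc : IsGHZClass ψ) (hφc : IsGHZClass φ) (h : interference ψ < interference φ) :
    ∃ m : ℝ, IsLeast (pBar ψ φ '' Set.Iic (interference ψ)) m ∧ optProb ψ φ ≤ m := by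
  have hle := interference_le_half hψ hψc
  obtain ⟨m, hm⟩ := exists_isLeast_pBar_Iic hle hφc h
  refine ⟨m, hm, ?_⟩
  obtain ⟨⟨x, hx, rfl⟩, -⟩ := hm
  have hx' : x ≤ interference ψ := hx
  exact optProb_le_pBar hψ hφ hψc hφc (hx'.trans hle) (hx'.trans_lt h).ne
    (div_nonneg (by linarith) (by linarith))

theorem exists_isLeast_pBar_of_gt {ψ φ : TriState 2 2 2} (hψ : ‖ψ‖ = 1) (hφ : ‖φ‖ = 1)
    (hψc : IsGHZClass ψ) (hφc : IsGHZClass φ) (h : interference φ < interference ψ) :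
    ∃ m : ℝ, IsLeast (pBar ψ φ '' Set.Icc (interference ψ) (1 / 2)) m ∧ optProb ψ φ ≤ m := by
  have hle := interference_le_half hψ hψc
  obtain ⟨m, hm⟩ := exists_isLeast_pBar_Icc hle h
  refine ⟨m, hm, ?_⟩
  obtain ⟨⟨x, hx, rfl⟩, -⟩ := hm
  exact optProb_le_pBar hψ hφ hψc hφc hx.2 (h.trans_le hx.1).ne'
    (div_nonneg_of_nonpos (by linarith [hx.1]) (by linarith [hx.1]))

theorem isLeast_pTangle {φ : TriState 2 2 2} (hb : 0 < interference φ) {z : ℝ} (hz : 0 ≤ z) :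
    IsLeast ((fun x => pBar ghz φ (-x)) '' Set.Icc 0 z) (pTangle φ z) := by
  have hcont : ContinuousOn (fun x => pBar ghz φ (-x)) (Set.Icc 0 z) :=
    (continuousOn_pBar ghz φ (s := Set.Iic 0) (fun x hx => le_trans (b := (0 : ℝ)) hx (by norm_num))
      (not_le.2 hb)).comp (by fun_prop) fun x hx => neg_nonpos.2 hx.1
  exact (isCompact_Icc.image_of_continuousOn hcont).isLeast_sInf
    ⟨_, Set.mem_image_of_mem _ ⟨le_rfl, hz⟩⟩

end TriState

theorem mainTheorem4 :
    -- the maxima of the 3-tangle at fixed interference term are attained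
    (∀ x : ℝ, x < 1 / 2 → IsGreatest (tangleSet x) (maxTangle x)) ∧
    -- from the GHZ state to the states `γ (|000⟩ + |aaa⟩)`
    (∀ c : ℝ, 0 < c → c < 1 →
      (∀ x : ℝ, 0 ≤ x → pAlready ghz (target c) (-x) = x / (c ^ 3 / (1 + c ^ 3) + x)) ∧
      (∀ z : ℝ, 0 ≤ z → IsLeast ((fun x => pBar ghz (target c) (-x)) '' Set.Icc 0 z)
        (pTangle (target c) z)) ∧
      ∃ m : ℝ, IsGreatest (pBound (target c) '' Set.Ici 0) m ∧
        IsLeast ((fun x => pBar ghz (target c) (-x)) '' Set.Ici 0) m ∧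
        optProb ghz (target c) ≤ m) ∧
    -- from any GHZ-class state to any other with a different interference term
    (∀ ψ φ : TriState 2 2 2, ‖ψ‖ = 1 → ‖φ‖ = 1 → IsGHZClass ψ → IsGHZClass φ →
      (interference ψ < interference φ →
        ∃ m : ℝ, IsLeast (pBar ψ φ '' Set.Iic (interference ψ)) m ∧ optProb ψ φ ≤ m) ∧
      (interference φ < interference ψ →
        ∃ m : ℝ, IsLeast (pBar ψ φ '' Set.Icc (interference ψ) (1 / 2)) m ∧
          optProb ψ φ ≤ m)) := by
  refine ⟨fun x hx => maxTangle_eq hx.le ▸ isGreatest_tangleBound hx, fun c h0 h1 => ?_,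
    fun ψ φ hψ hφ hψc hφc => ⟨exists_isLeast_pBar_of_lt hψ hφ hψc hφc,
      exists_isLeast_pBar_of_gt hψ hφ hψc hφc⟩⟩
  have hc : -1 < c := by linarith
  have hI := interference_target hc h1
  have hb : 0 < interference (target c) := by rw [hI]; positivity
  have hcl := isGHZClass_target hc h1
  refine ⟨fun x _ => ?_, fun z hz => isLeast_pTangle hb hz, ?_⟩
  · rw [pAlready, interference_ghz, hI, sub_neg_eq_add, sub_neg_eq_add, zero_add]
  · obtain ⟨m, hm, hopt⟩ := exists_isLeast_pBar_of_lt norm_ghz (norm_target hc h1) isGHZClass_ghz hcl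
      (interference_ghz.symm ▸ hb)
    have hset : (fun x => pBar ghz (target c) (-x)) '' Set.Ici 0 =
        pBar ghz (target c) '' Set.Iic (interference ghz) := by
      rw [interference_ghz, ← Set.image_image (pBar ghz (target c)) (fun x => -x),
        Set.image_neg_eq_neg, Set.neg_Ici, neg_zero]
    rw [← hset] at hm
    exact ⟨m, pBound_isGreatest hcl hb hm, hm, hopt⟩
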